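/- Let $\Omega\subset\mathbb R^2$ be open and let $f:\Omega\to\mathbb R^3$ be a smooth conjugate net, that is, $f$ is $C^\infty$, $f_u$ and $f_v$ are linearly independent at every point, and $f_{uv}=a\,f_u+b\,f_v$ for some functions $a,b:\Omega\to\mathbb R$. Assume that $f$ has no parabolic points, that is, there is no point of $\Omega$ at which $(f_{uv}\times f_u)\cdot f_v=0$ and at least one of $(f_{uu}\times f_u)\cdot f_v$, $(f_{vv}\times f_u)\cdot f_v$ vanishes. Let $K\subset\Omega$ be compact and let $(u_0,v_0)\in\mathbb R^2$. For $\varepsilon>0$ put $p^\varepsilon_{ij}=(u_0+i\varepsilon,v_0+j\varepsilon)$ and $I_\varepsilon=\{(i,j)\in\mathbb Z^2: p^\varepsilon_{ij}\in K\}$, and write $f_{ij}=f(p^\varepsilon_{ij})$ for $(i,j)\in I_\varepsilon$. Then there are constants $C>0$ and $\varepsilon_0>0$, depending only on $f$, $\Omega$, $K$, $u_0$, $v_0$, such that for every $0<\varepsilon<\varepsilon_0$ there is a family of points $f^\varepsilon_{ij}\in\mathbb R^3$ with the following properties: 1. it is a discrete conjugate net: whenever $(i,j),(i+1,j),(i+1,j+1),(i,j+1)\in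 I_\varepsilon$, the four points $f^\varepsilon_{ij}, f^\varepsilon_{i+1,j}, f^\varepsilon_{i+1,j+1}, f^\varepsilon_{i,j+1}$ lie in a plane; 2. for every $(i,j)\in I_\varepsilon$ the vertex $f^\varepsilon_{ij}$ lies on the surface $f(\Omega)$ and $d(f_{ij},f^\varepsilon_{ij})\le C\varepsilon^2$; 3. the even columns and the initial row are those of the smooth net: $f^\varepsilon_{2i,j}=f_{2i,j}$ whenever $(2i,j)\in I_\varepsilon$, and $f^\varepsilon_{i,0}=f_{i,0}$ whenever $(i,0)\in I_\varepsilon$. -/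

import Mathlib

open scoped ContDiff

noncomputable section

/-- Partial derivative in the first parameter `u`. -/
def partialU (f : ℝ × ℝ → EuclideanSpace ℝ (Fin 3)) (p : ℝ × ℝ) : EuclideanSpace ℝ (Fin 3) :=
  fderiv ℝ f p (1, 0)

/-- Partial derivative in the second parameter `v`. -/
def partialV (f : ℝ × ℝ → EuclideanSpace ℝ (Fin 3)) (p : ℝ × ℝ) : EuclideanSpace ℝ (Fin 3) :=
  fderiv ℝ f p (0, 1)

/-- The triple product `(x × y) · z` of vectors of Euclidean 3-space. -/
def tripleProduct (x y z : EuclideanSpace ℝ (Fin 3)) : ℝ :=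
  (crossProduct x.ofLp y.ofLp) ⬝ᵥ z.ofLp

/-- A smooth conjugate net `f : Ω → ℝ³`: a smooth regular parametrized surface with
`f_uv = a f_u + b f_v` for some functions `a`, `b` on `Ω`. -/
structure IsSmoothConjugateNet (f : ℝ × ℝ → EuclideanSpace ℝ (Fin 3)) (Ω : Set (ℝ × ℝ)) :
    Prop where
  isOpen : IsOpen Ω
  smooth : ContDiffOn ℝ ∞ f Ω
  regular : ∀ p ∈ Ω, LinearIndependent ℝ ![partialU f p, partialV f p]
  conjugate : ∃ a b : ℝ × ℝ → ℝ, ∀ p ∈ Ω,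
    partialV (partialU f) p = a p • partialU f p + b p • partialV f p

/-- A parabolic point of a net: the mixed coefficient of the second fundamental form and at least
one of the two other coefficients vanish (the coefficients are taken up to the common nonzero
factor `|f_u × f_v|`). -/
def IsParabolicPoint (f : ℝ × ℝ → EuclideanSpace ℝ (Fin 3)) (p : ℝ × ℝ) : Prop :=
  tripleProduct (partialV (partialU f) p) (partialU f p) (partialV f p) = 0 ∧
    (tripleProduct (partialU (partialU f) p) (partialU f p) (partialV f p) = 0 ∨
      tripleProduct (partialV (partialV f) p) (partialU f p) (partialV f p) = 0)

/-- The point with index `(i, j)` of the square lattice of mesh `ε` through `p₀`. -/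
def latticePoint (p₀ : ℝ × ℝ) (ε : ℝ) (i j : ℤ) : ℝ × ℝ :=
  (p₀.1 + i * ε, p₀.2 + j * ε)

/-- A discrete conjugate net on a set `I` of indices: each elementary quadrangle all of whose
four vertices have their index in `I` is planar. -/
def IsDiscreteConjugateNet (I : Set (ℤ × ℤ)) (F : ℤ → ℤ → EuclideanSpace ℝ (Fin 3)) : Prop :=
  ∀ i j : ℤ, (i, j) ∈ I → (i + 1, j) ∈ I → (i + 1, j + 1) ∈ I → (i, j + 1) ∈ I →
    Coplanar ℝ {F i j, F (i + 1) j, F (i + 1) (j + 1), F i (j + 1)}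

end

/-! Only the odd columns are moved, and only along the surface: the new vertex is `f (p + ε • D)`
with `D = 0` on row `0`. The two columns next to an odd one are fixed, so odd columns are
independent of each other. Along one of them each new vertex has two free parameters and must
satisfy two equations, the planarity of the quadrangles on its left and right. The column is solved
upwards and downwards from row `0`.

In units of the mesh, let `w` be the perturbation of the known vertex and `w'` that of the next one.
The volume of the perturbed quadrangle is `ε⁴ (Q(w, w') + ε S(w, w'))` with `S` bounded and
Lipschitz uniformly in the step (`exists_expansion`). Because `f_uv` is tangent, `Q` is the volume
for the quadric `z = (L u² + N v²) / 2`. There the reflection `w' = (w.1, -w.2)` solves both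
equations exactly, and the linearization at `w = 0` is invertible because `L` and `N` are nonzero,
which is the absence of parabolic points. A contraction argument then solves the true equations near
the reflected vector.

Two facts keep the error small over the roughly `1/ε` steps. The reflection preserves the norm, so a
step amplifies by a factor `1 + O(ε)` only. The quadrangles of the smooth net have volume `O(ε⁶)`
(`abs_quadVolume_zero_le`), so `S(0, 0) = O(ε)` and a step adds only `O(ε²)`. Hence `‖w'‖ ≤ (1 + Cε)
‖w‖ + C ε²` (`exists_step`). The discrete Grönwall inequality gives `‖D‖ = O(ε)`, that is, a
displacement `O(ε²)` on the surface. -/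

set_option maxSynthPendingDepth 6

local notation "E3" => EuclideanSpace ℝ (Fin 3)

/-! ### Taylor estimates of third and fourth order -/

section Taylor
variable {E F : Type*} [NormedAddCommGroup E] [NormedSpace ℝ E]
  [NormedAddCommGroup F] [NormedSpace ℝ F]

/-- A map whose derivative is bounded by `C` on the ball of radius `s` about `0` is `C`-Lipschitz
there. -/
theorem norm_sub_le_of_hasFDerivAt_ball {g : E → F} {g' : E → E →L[ℝ] F} {C s : ℝ}
    (hg : ∀ z, ‖z‖ ≤ s → HasFDerivAt g (g' z) z) (hb : ∀ z, ‖z‖ ≤ s → ‖g' z‖ ≤ C)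
    {z z' : E} (hz : ‖z‖ ≤ s) (hz' : ‖z'‖ ≤ s) : ‖g z - g z'‖ ≤ C * ‖z - z'‖ := by
  refine (convex_closedBall (0 : E) s).norm_image_sub_le_of_norm_hasFDerivWithin_le (f' := g')
    (fun x hx => (hg x (by simpa using hx)).hasFDerivWithinAt) (fun x hx => hb x (by simpa using hx))
    (by simpa using hz') (by simpa using hz)

theorem hasFDerivAt_comp_const_add {g : E → F} {g' : E →L[ℝ] F} {c z : E}
    (h : HasFDerivAt g g' (c + z)) : HasFDerivAt (fun z => g (c + z)) g' z := by
  have := h.comp z ((hasFDerivAt_id z).const_add c)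
  rwa [ContinuousLinearMap.comp_id] at this

theorem hasFDerivAt_comp_const_sub {g : E → F} {g' : E →L[ℝ] F} {c z : E}
    (h : HasFDerivAt g g' (c - z)) : HasFDerivAt (fun z => g (c - z)) (-g') z := by
  have := h.comp z ((hasFDerivAt_id z).const_sub c)
  have e : g' ∘SL (-ContinuousLinearMap.id ℝ E) = -g' := by ext; simp
  rwa [e] at this

theorem hasFDerivAt_diag {b : E →L[ℝ] E →L[ℝ] F} (hb : ∀ x y, b x y = b y x) (z : E) :
    HasFDerivAt (fun z => b z z) ((2 : ℝ) • b z) z := by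
  have h := b.hasFDerivAt (x := z) |>.clm_apply (hasFDerivAt_id z)
  have e : b z ∘SL ContinuousLinearMap.id ℝ E + b.flip (id z) = (2 : ℝ) • b z := by
    ext y; simp [hb y z, two_smul]
  rwa [e] at h

/-- A three times differentiable map with its first three derivatives on a closed ball. -/
structure HasTower (f : E → F) (f1 : E → E →L[ℝ] F) (f2 : E → E →L[ℝ] E →L[ℝ] F)
    (f3 : E → E →L[ℝ] E →L[ℝ] E →L[ℝ] F) (c : E) (ρ : ℝ) : Prop where
  d0 : ∀ x ∈ Metric.closedBall c ρ, HasFDerivAt f (f1 x) x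
  d1 : ∀ x ∈ Metric.closedBall c ρ, HasFDerivAt f1 (f2 x) x
  d2 : ∀ x ∈ Metric.closedBall c ρ, HasFDerivAt f2 (f3 x) x
  symm : ∀ x y, f2 c x y = f2 c y x

variable {f : E → F} {f1 : E → E →L[ℝ] F} {f2 : E → E →L[ℝ] E →L[ℝ] F}
    {f3 : E → E →L[ℝ] E →L[ℝ] E →L[ℝ] F} {c : E} {ρ : ℝ}

/-- The remainder of the second order Taylor polynomial at `c`. -/
noncomputable def taylorRem (f : E → F) (f1 : E →L[ℝ] F) (f2 : E →L[ℝ] E →L[ℝ] F) (c z : E) : F :=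
  f (c + z) - f c - f1 z - (1 / 2 : ℝ) • f2 z z

/-- The remainder has derivative `f1 (c + z) - f1 c - f2 c z`, and each use of the mean value
inequality gains a factor `s` over the bound of `f3`. A Lipschitz estimate is needed, not just a
bound, because the remainder enters a contraction argument. -/
theorem HasTower.taylorRem_lipschitz (h : HasTower f f1 f2 f3 c ρ) {B s : ℝ}
    (hB : ∀ x ∈ Metric.closedBall c ρ, ‖f3 x‖ ≤ B) (hs : s ≤ ρ) {z z' : E}
    (hz : ‖z‖ ≤ s) (hz' : ‖z'‖ ≤ s) :
    ‖taylorRem f (f1 c) (f2 c) c z - taylorRem f (f1 c) (f2 c) c z'‖ ≤ B * s ^ 2 * ‖z - z'‖ := by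
  have hs0 : 0 ≤ s := (norm_nonneg _).trans hz
  have hB0 : 0 ≤ B := (norm_nonneg _).trans (hB c (by simp [hs0.trans hs]))
  have mem : ∀ x : E, ‖x‖ ≤ s → c + x ∈ Metric.closedBall c ρ := fun x hx => by
    simpa using hx.trans hs
  have e2 : ∀ x : E, ‖x‖ ≤ s → ‖f2 (c + x) - f2 c‖ ≤ B * s := fun x hx => by
    have := norm_sub_le_of_hasFDerivAt_ball (g := fun z => f2 (c + z)) (g' := fun z => f3 (c + z))
      (fun z hz => hasFDerivAt_comp_const_add (h.d2 _ (mem z hz))) (fun z hz => hB _ (mem z hz))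
      hx (z' := 0) (by simpa using hs0)
    simp only [add_zero, sub_zero] at this
    exact this.trans (by gcongr)
  have e1 : ∀ x : E, ‖x‖ ≤ s → ‖f1 (c + x) - f1 c - f2 c x‖ ≤ B * s ^ 2 := fun x hx => by
    have := norm_sub_le_of_hasFDerivAt_ball (g := fun z => f1 (c + z) - f1 c - f2 c z)
      (g' := fun z => f2 (c + z) - f2 c)
      (fun z hz => ((hasFDerivAt_comp_const_add (h.d1 _ (mem z hz))).sub_const _).sub
        (f2 c).hasFDerivAt) e2 hx (z' := 0) (by simpa using hs0)
    simp only [add_zero, sub_zero, map_zero, sub_self] at this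
    calc _ ≤ _ := this
      _ ≤ B * s * s := by gcongr
      _ = _ := by ring
  refine norm_sub_le_of_hasFDerivAt_ball (g := taylorRem f (f1 c) (f2 c) c)
      (g' := fun z => f1 (c + z) - f1 c - f2 c z) (fun z hz => ?_) e1 hz hz'
  have := (((hasFDerivAt_comp_const_add (h.d0 _ (mem z hz))).sub_const (f c)).sub
        (f1 c).hasFDerivAt).sub ((hasFDerivAt_diag h.symm z).const_smul (1 / 2 : ℝ))
  have e : (1 / 2 : ℝ) • (2 : ℝ) • f2 c z = f2 c z := by simp [smul_smul]
  rw [e] at this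
  exact this

theorem HasTower.norm_taylorRem_le (h : HasTower f f1 f2 f3 c ρ) {B s : ℝ}
    (hB : ∀ x ∈ Metric.closedBall c ρ, ‖f3 x‖ ≤ B) (hs : s ≤ ρ) {z : E}
    (hz : ‖z‖ ≤ s) : ‖taylorRem f (f1 c) (f2 c) c z‖ ≤ B * s ^ 3 := by
  have hs0 : 0 ≤ s := (norm_nonneg _).trans hz
  have hB0 : 0 ≤ B := (norm_nonneg _).trans (hB c (by simp [hs0.trans hs]))
  have := h.taylorRem_lipschitz hB hs hz (z' := 0) (by simpa using hs0)
  have h0 : taylorRem f (f1 c) (f2 c) c 0 = 0 := by simp [taylorRem]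
  rw [h0, sub_zero, sub_zero] at this
  calc _ ≤ _ := this
    _ ≤ B * s ^ 2 * s := by gcongr
    _ = _ := by ring

/-- The even part of a map agrees with its quadratic Taylor polynomial up to fourth order. -/
theorem HasTower.norm_even_part_le (h : HasTower f f1 f2 f3 c ρ)
    {f4 : E → E →L[ℝ] E →L[ℝ] E →L[ℝ] E →L[ℝ] F}
    (h3 : ∀ x ∈ Metric.closedBall c ρ, HasFDerivAt f3 (f4 x) x) {B s : ℝ}
    (hB : ∀ x ∈ Metric.closedBall c ρ, ‖f4 x‖ ≤ B) (hs : s ≤ ρ) {z : E} (hz : ‖z‖ ≤ s) :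
    ‖f (c + z) + f (c - z) - (2 : ℝ) • f c - f2 c z z‖ ≤ 2 * B * s ^ 4 := by
  have hs0 : 0 ≤ s := (norm_nonneg _).trans hz
  have h0s : ‖(0 : E)‖ ≤ s := by simpa using hs0
  have hB0 : 0 ≤ B := (norm_nonneg (f4 c)).trans (hB c (by simp [hs0.trans hs]))
  have mem : ∀ x : E, ‖x‖ ≤ s → c + x ∈ Metric.closedBall c ρ := fun x hx => by
    simpa using hx.trans hs
  have mem' : ∀ x : E, ‖x‖ ≤ s → c - x ∈ Metric.closedBall c ρ := fun x hx => by
    simpa [sub_eq_add_neg] using mem (-x) (by simpa using hx)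
  -- The derivatives of the even combination alternate between differences and sums. `e3` compares
  -- `f3` at `c + x` and `c - x` directly; the later combinations vanish at `0`. Four uses of the
  -- mean value inequality therefore give `s ^ 4`.
  have e3 : ∀ x : E, ‖x‖ ≤ s → ‖f3 (c + x) + -f3 (c - x)‖ ≤ 2 * B * s := fun x hx => by
    have := norm_sub_le_of_hasFDerivAt_ball (g := fun z => f3 (c + z)) (g' := fun z => f4 (c + z))
      (fun z hz => hasFDerivAt_comp_const_add (h3 _ (mem z hz))) (fun z hz => hB _ (mem z hz))
      hx (z' := -x) (by simpa using hx)
    simp only [← sub_eq_add_neg] at this ⊢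
    calc _ ≤ _ := this
      _ ≤ B * (s + s) := by gcongr; exact (norm_sub_le _ _).trans (by simp; linarith)
      _ = _ := by ring
  have e2 : ∀ x : E, ‖x‖ ≤ s → ‖f2 (c + x) + f2 (c - x) - (2 : ℝ) • f2 c‖ ≤ 2 * B * s ^ 2 :=
      fun x hx => by
    have := norm_sub_le_of_hasFDerivAt_ball (g := fun z => f2 (c + z) + f2 (c - z) - (2 : ℝ) • f2 c)
      (g' := fun z => f3 (c + z) + -f3 (c - z))
      (fun z hz => ((hasFDerivAt_comp_const_add (h.d2 _ (mem z hz))).add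
        (hasFDerivAt_comp_const_sub (h.d2 _ (mem' z hz)))).sub_const _) e3 hx h0s
    simp only [add_zero, sub_zero, ← two_smul ℝ, sub_self] at this
    rw [two_smul ℝ (f2 c)] at this ⊢
    calc _ ≤ _ := this
      _ ≤ 2 * B * s * s := by gcongr
      _ = _ := by ring
  have e1 : ∀ x : E, ‖x‖ ≤ s → ‖f1 (c + x) + -f1 (c - x) - (2 : ℝ) • f2 c x‖ ≤ 2 * B * s ^ 3 :=
      fun x hx => by
    have := norm_sub_le_of_hasFDerivAt_ball (g := fun z => f1 (c + z) + -f1 (c - z) - (2 : ℝ) • f2 c z)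
      (g' := fun z => f2 (c + z) + f2 (c - z) - (2 : ℝ) • f2 c)
      (fun z hz => by
        have := ((hasFDerivAt_comp_const_add (h.d1 _ (mem z hz))).add
          (hasFDerivAt_comp_const_sub (h.d1 _ (mem' z hz))).neg).sub
          ((f2 c).hasFDerivAt.const_smul (2 : ℝ))
        rwa [neg_neg] at this) e2 hx h0s
    simp only [add_zero, sub_zero, map_zero, smul_zero, add_neg_cancel] at this
    calc _ ≤ _ := this
      _ ≤ 2 * B * s ^ 2 * s := by gcongr
      _ = _ := by ring
  have := norm_sub_le_of_hasFDerivAt_ball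
      (g := fun z => f (c + z) + f (c - z) - (2 : ℝ) • f c - f2 c z z)
      (g' := fun z => f1 (c + z) + -f1 (c - z) - (2 : ℝ) • f2 c z)
      (fun z hz => (((hasFDerivAt_comp_const_add (h.d0 _ (mem z hz))).add
          (hasFDerivAt_comp_const_sub (h.d0 _ (mem' z hz)))).sub_const _).sub
          (hasFDerivAt_diag h.symm z)) e1 hz h0s
  simp only [add_zero, sub_zero, map_zero, ← two_smul ℝ, sub_self] at this
  calc _ ≤ _ := this
    _ ≤ 2 * B * s ^ 3 * s := by gcongr
    _ = _ := by ring

end Taylor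

/-! ### Triple products and coplanarity -/

section TripleProduct

theorem tripleProduct_apply (x y z : E3) : tripleProduct x y z =
    (x 1 * y 2 - x 2 * y 1) * z 0 + (x 2 * y 0 - x 0 * y 2) * z 1 +
      (x 0 * y 1 - x 1 * y 0) * z 2 := by
  simp [tripleProduct, crossProduct, dotProduct, Fin.sum_univ_three]

/-- Each of the six monomials of the determinant is at most `‖x‖ * ‖y‖ * ‖z‖`; the sharp constant
`1` is not needed. -/
theorem abs_tripleProduct_le (x y z : E3) : |tripleProduct x y z| ≤ 6 * ‖x‖ * ‖y‖ * ‖z‖ := by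
  have h : ∀ i j k, |x i * y j * z k| ≤ ‖x‖ * ‖y‖ * ‖z‖ := fun i j k => by
    rw [abs_mul, abs_mul]
    gcongr
    exacts [PiLp.norm_apply_le x i, PiLp.norm_apply_le y j, PiLp.norm_apply_le z k]
  have e : tripleProduct x y z = x 1 * y 2 * z 0 - x 2 * y 1 * z 0 + x 2 * y 0 * z 1 -
      x 0 * y 2 * z 1 + x 0 * y 1 * z 2 - x 1 * y 0 * z 2 := by
    rw [tripleProduct_apply]; ring
  rw [e, abs_le]
  have h1 := abs_le.1 (h 1 2 0)
  have h2 := abs_le.1 (h 2 1 0)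
  have h3 := abs_le.1 (h 2 0 1)
  have h4 := abs_le.1 (h 0 2 1)
  have h5 := abs_le.1 (h 0 1 2)
  have h6 := abs_le.1 (h 1 0 2)
  constructor <;> linarith [h1.1, h1.2, h2.1, h2.2, h3.1, h3.2, h4.1, h4.2, h5.1, h5.2, h6.1, h6.2]

theorem coplanar_of_tripleProduct_eq_zero {p₀ p₁ p₂ p₃ : E3}
    (h : tripleProduct (p₁ - p₀) (p₂ - p₀) (p₃ - p₀) = 0) :
    Coplanar ℝ {p₀, p₁, p₂, p₃} := by
  have hd : ¬ LinearIndependent ℝ ![p₁ - p₀, p₂ - p₀, p₃ - p₀] := by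
    have hdet : (Matrix.of fun i => (![p₁ - p₀, p₂ - p₀, p₃ - p₀] i).ofLp).det = 0 := by
      rw [tripleProduct_apply] at h
      rw [Matrix.det_fin_three]
      simp at h ⊢
      linarith
    intro hli
    have h2 : LinearIndependent ℝ (fun i => (![p₁ - p₀, p₂ - p₀, p₃ - p₀] i).ofLp) :=
      hli.map' (WithLp.linearEquiv 2 ℝ (Fin 3 → ℝ)).toLinearMap
        (LinearEquiv.ker _)
    have h3 := Matrix.linearIndependent_rows_iff_isUnit (K := ℝ)
      (A := Matrix.of fun i => (![p₁ - p₀, p₂ - p₀, p₃ - p₀] i).ofLp) |>.1 h2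
    rw [Matrix.isUnit_iff_isUnit_det, hdet] at h3
    simp at h3
  have hspan : vectorSpan ℝ ({p₀, p₁, p₂, p₃} : Set E3) =
      Submodule.span ℝ (Set.range ![p₁ - p₀, p₂ - p₀, p₃ - p₀]) := by
    rw [vectorSpan_eq_span_vsub_set_right ℝ (p := p₀) (by simp)]
    simp only [vsub_eq_sub, Set.image_insert_eq, sub_self, Set.image_singleton,
      Submodule.span_insert_zero, Matrix.range_cons, Matrix.range_empty, Set.union_empty,
      Set.singleton_union]
  rw [coplanar_iff_finrank_le_two, hspan]
  by_contra hc
  refine hd (linearIndependent_iff_card_le_finrank_span.2 ?_)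
  rw [Fintype.card_fin, Set.finrank]
  omega

/-- If `x`, `y`, `d` are within `α`, `α`, `δ` of the vectors `x'`, `y'`, `d'` of a plane through `0`
then their triple product is small. -/
theorem abs_tripleProduct_le_of_near {x y d x' y' d' : E3} {A D α δ : ℝ}
    (h0 : tripleProduct x' y' d' = 0) (hx : ‖x‖ ≤ A) (hy : ‖y‖ ≤ A) (hx' : ‖x'‖ ≤ A)
    (hd : ‖d‖ ≤ D) (hy' : ‖y'‖ ≤ A) (hxx : ‖x - x'‖ ≤ α) (hyy : ‖y - y'‖ ≤ α)
    (hdd : ‖d - d'‖ ≤ δ) :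
    |tripleProduct x y d| ≤ 12 * α * A * D + 6 * A ^ 2 * δ := by
  -- The vectors are exchanged one at a time, `d` last, so that `α` is multiplied by the size `D` of
  -- `d`. In the application `D` is quadratic in the mesh.
  have e : tripleProduct x y d = tripleProduct (x - x') y d + tripleProduct x' (y - y') d +
      tripleProduct x' y' (d - d') := by
    simp only [tripleProduct_apply, PiLp.sub_apply] at h0 ⊢
    linear_combination h0
  have hA : 0 ≤ A := (norm_nonneg _).trans hx
  have hα : 0 ≤ α := (norm_nonneg _).trans hxx
  have hD : 0 ≤ D := (norm_nonneg _).trans hd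
  rw [e]
  calc _ ≤ |tripleProduct (x - x') y d| + |tripleProduct x' (y - y') d| +
      |tripleProduct x' y' (d - d')| := abs_add_three _ _ _
    _ ≤ 6 * α * A * D + 6 * A * α * D + 6 * A * A * δ := by
      gcongr
      · exact (abs_tripleProduct_le _ _ _).trans (by gcongr)
      · exact (abs_tripleProduct_le _ _ _).trans (by gcongr)
      · exact (abs_tripleProduct_le _ _ _).trans (by gcongr)
    _ = _ := by ring

end TripleProduct

/-! ### Families of maps with uniform bounds and Lipschitz constants -/

section BoundedLipschitz

variable {ι W W' E : Type*} [PseudoMetricSpace W] [PseudoMetricSpace W']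
  [NormedAddCommGroup E]

/-- A family of maps with a common bound and a common Lipschitz constant on the set `s`. -/
def UniformlyBoundedLipschitz (g : ι → W → E) (s : Set W) : Prop :=
  ∃ C : ℝ, ∀ i, ∀ w ∈ s, ‖g i w‖ ≤ C ∧ ∀ w' ∈ s, ‖g i w - g i w'‖ ≤ C * dist w w'

namespace UniformlyBoundedLipschitz

variable {s : Set W} {g h : ι → W → E}

theorem exists_nonneg (hg : UniformlyBoundedLipschitz g s) : ∃ C : ℝ, 0 ≤ C ∧
    ∀ i, ∀ w ∈ s, ‖g i w‖ ≤ C ∧ ∀ w' ∈ s, ‖g i w - g i w'‖ ≤ C * dist w w' := by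
  obtain ⟨C, hC⟩ := hg
  refine ⟨max C 0, le_max_right _ _, fun i w hw => ⟨(hC i w hw).1.trans (le_max_left _ _),
    fun w' hw' => ((hC i w hw).2 w' hw').trans ?_⟩⟩
  gcongr
  exact le_max_left _ _

theorem const {x : ι → E} {C : ℝ} (h : ∀ i, ‖x i‖ ≤ C) :
    UniformlyBoundedLipschitz (fun i (_ : W) => x i) s := by
  refine ⟨C, fun i w _ => ⟨h i, fun w' _ => ?_⟩⟩
  have := (norm_nonneg _).trans (h i)
  simp only [sub_self, norm_zero]
  positivity

theorem add (hg : UniformlyBoundedLipschitz g s) (hh : UniformlyBoundedLipschitz h s) :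
    UniformlyBoundedLipschitz (fun i w => g i w + h i w) s := by
  obtain ⟨C, hC⟩ := hg
  obtain ⟨D, hD⟩ := hh
  refine ⟨C + D, fun i w hw => ⟨(norm_add_le _ _).trans (add_le_add (hC i w hw).1 (hD i w hw).1),
    fun w' hw' => ?_⟩⟩
  rw [add_sub_add_comm, add_mul]
  exact (norm_add_le _ _).trans (add_le_add ((hC i w hw).2 w' hw') ((hD i w hw).2 w' hw'))

theorem smul [NormedSpace ℝ E] {a : ι → W → ℝ} (ha : UniformlyBoundedLipschitz a s)
    (hg : UniformlyBoundedLipschitz g s) :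
    UniformlyBoundedLipschitz (fun i w => a i w • g i w) s := by
  obtain ⟨C, hC0, hC⟩ := ha.exists_nonneg
  obtain ⟨D, hD0, hD⟩ := hg.exists_nonneg
  -- The product rule for Lipschitz constants gives `C * D` twice.
  refine ⟨2 * (C * D), fun i w hw => ⟨?_, fun w' hw' => ?_⟩⟩
  · rw [norm_smul]
    have : ‖a i w‖ * ‖g i w‖ ≤ C * D := by
      gcongr
      exacts [(hC i w hw).1, (hD i w hw).1]
    nlinarith [mul_nonneg hC0 hD0]
  · have e : a i w • g i w - a i w' • g i w' =
        a i w • (g i w - g i w') + (a i w - a i w') • g i w' := by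
      rw [smul_sub, sub_smul]; abel
    rw [e]
    calc _ ≤ ‖a i w‖ * ‖g i w - g i w'‖ + ‖a i w - a i w'‖ * ‖g i w'‖ := by
          rw [← norm_smul, ← norm_smul]; exact norm_add_le _ _
      _ ≤ C * (D * dist w w') + C * dist w w' * D := by
          gcongr
          exacts [(hC i w hw).1, (hD i w hw).2 w' hw', (hC i w hw).2 w' hw', (hD i w' hw').1]
      _ = _ := by ring

theorem mul {a b : ι → W → ℝ} (ha : UniformlyBoundedLipschitz a s)
    (hb : UniformlyBoundedLipschitz b s) : UniformlyBoundedLipschitz (fun i w => a i w * b i w) s :=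
  ha.smul hb

theorem neg [NormedSpace ℝ E] (hg : UniformlyBoundedLipschitz g s) :
    UniformlyBoundedLipschitz (fun i w => - g i w) s := by
  simpa using (const (x := fun _ : ι => (-1 : ℝ)) (C := 1) (W := W) (by simp)).smul hg

theorem sub [NormedSpace ℝ E] (hg : UniformlyBoundedLipschitz g s) (hh : UniformlyBoundedLipschitz h s) :
    UniformlyBoundedLipschitz (fun i w => g i w - h i w) s := by
  simpa [sub_eq_add_neg] using hg.add hh.neg

theorem comp {t : Set W'} {φ : ι → W' → W} (hg : UniformlyBoundedLipschitz g s)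
    (hφ : ∀ i, ∀ w ∈ t, φ i w ∈ s) (hl : ∀ i w w', dist (φ i w) (φ i w') ≤ dist w w') :
    UniformlyBoundedLipschitz (fun i w => g i (φ i w)) t := by
  obtain ⟨C, hC0, hC⟩ := hg.exists_nonneg
  refine ⟨C, fun i w hw => ⟨(hC i _ (hφ i w hw)).1, fun w' hw' =>
    ((hC i _ (hφ i w hw)).2 _ (hφ i w' hw')).trans ?_⟩⟩
  gcongr
  exact hl i w w'

theorem apply {g : ι → W → EuclideanSpace ℝ (Fin 3)} (hg : UniformlyBoundedLipschitz g s)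
    (k : Fin 3) : UniformlyBoundedLipschitz (fun i w => g i w k) s := by
  obtain ⟨C, hC⟩ := hg
  refine ⟨C, fun i w hw => ⟨(PiLp.norm_apply_le (g i w) k).trans (hC i w hw).1, fun w' hw' => ?_⟩⟩
  exact (PiLp.norm_apply_le (g i w - g i w') k).trans ((hC i w hw).2 w' hw')

theorem tripleProduct {x y z : ι → W → EuclideanSpace ℝ (Fin 3)}
    (hx : UniformlyBoundedLipschitz x s) (hy : UniformlyBoundedLipschitz y s)
    (hz : UniformlyBoundedLipschitz z s) :
    UniformlyBoundedLipschitz (fun i w => tripleProduct (x i w) (y i w) (z i w)) s := by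
  simp only [tripleProduct_apply]
  exact (((((hx.apply 1).mul (hy.apply 2)).sub ((hx.apply 2).mul (hy.apply 1))).mul (hz.apply 0)).add
    ((((hx.apply 2).mul (hy.apply 0)).sub ((hx.apply 0).mul (hy.apply 2))).mul (hz.apply 1))).add
    ((((hx.apply 0).mul (hy.apply 1)).sub ((hx.apply 1).mul (hy.apply 0))).mul (hz.apply 2))

end UniformlyBoundedLipschitz

end BoundedLipschitz

/-! ### A quantitative fixed point principle -/

/-- A map that is `1/2`-Lipschitz on the ball of radius `r` about `0` and moves `0` by at most `r/2`
has a fixed point of norm at most twice the displacement of `0`. -/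
theorem exists_fixedPoint_of_half_lipschitz {E : Type*} [NormedAddCommGroup E] [CompleteSpace E]
    {Ψ : E → E} {r : ℝ} (h0 : 2 * ‖Ψ 0‖ ≤ r)
    (hl : ∀ z z', ‖z‖ ≤ r → ‖z'‖ ≤ r → ‖Ψ z - Ψ z'‖ ≤ 1 / 2 * ‖z - z'‖) :
    ∃ z, ‖z‖ ≤ 2 * ‖Ψ 0‖ ∧ Ψ z = z := by
  -- With this radius the ball is invariant, since `‖Ψ z‖ ≤ ‖z‖ / 2 + ‖Ψ 0‖`.
  set s := Metric.closedBall (0 : E) (2 * ‖Ψ 0‖)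
  have hr : ∀ z ∈ s, ‖z‖ ≤ r := fun z hz => by
    have : ‖z‖ ≤ 2 * ‖Ψ 0‖ := by simpa [s] using hz
    exact this.trans h0
  have hmaps : Set.MapsTo Ψ s s := fun z hz => by
    have h1 := hl z 0 (hr z hz) (by simpa using (by positivity : 0 ≤ 2 * ‖Ψ 0‖).trans h0)
    have h2 : ‖z‖ ≤ 2 * ‖Ψ 0‖ := by simpa [s] using hz
    have h3 : ‖Ψ z‖ ≤ ‖Ψ z - Ψ 0‖ + ‖Ψ 0‖ := by
      simpa using norm_add_le (Ψ z - Ψ 0) (Ψ 0)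
    rw [sub_zero] at h1
    simp only [s, Metric.mem_closedBall, dist_zero_right]
    linarith
  have hc : ContractingWith (1 / 2) (hmaps.restrict Ψ s s) := by
    refine ⟨by norm_num, LipschitzWith.of_dist_le_mul fun x y => ?_⟩
    rw [Subtype.dist_eq, Subtype.dist_eq, dist_eq_norm, dist_eq_norm]
    simpa using hl x y (hr x x.2) (hr y y.2)
  obtain ⟨z, hz, hfix, -⟩ := hc.exists_fixedPoint' Metric.isClosed_closedBall.isComplete hmaps
    (x := 0) (by simp [s]) (edist_ne_top _ _)
  exact ⟨z, by simpa [s] using hz, hfix⟩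

/-! ### Trilinear expansion of a volume in powers of the mesh -/

section Trilinear

variable (x x' y y' z z' : EuclideanSpace ℝ (Fin 3)) (t : ℝ)

theorem tripleProduct_add_left :
    tripleProduct (x + x') y z = tripleProduct x y z + tripleProduct x' y z := by
  simp only [tripleProduct_apply, PiLp.add_apply]; ring

theorem tripleProduct_add_mid :
    tripleProduct x (y + y') z = tripleProduct x y z + tripleProduct x y' z := by
  simp only [tripleProduct_apply, PiLp.add_apply]; ring

theorem tripleProduct_add_right :
    tripleProduct x y (z + z') = tripleProduct x y z + tripleProduct x y z' := by
  simp only [tripleProduct_apply, PiLp.add_apply]; ring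

theorem tripleProduct_smul_left : tripleProduct (t • x) y z = t * tripleProduct x y z := by
  simp only [tripleProduct_apply, PiLp.smul_apply, smul_eq_mul]; ring

theorem tripleProduct_smul_mid : tripleProduct x (t • y) z = t * tripleProduct x y z := by
  simp only [tripleProduct_apply, PiLp.smul_apply, smul_eq_mul]; ring

theorem tripleProduct_smul_right : tripleProduct x y (t • z) = t * tripleProduct x y z := by
  simp only [tripleProduct_apply, PiLp.smul_apply, smul_eq_mul]; ring

end Trilinear

/-- The expansion in powers of `ε` of the triple product of three vectors that are, to first order,
parallel to a common plane. -/
theorem tripleProduct_expansion {a₁ a₂ a₃ b₁ b₂ b₃ r₁ r₂ r₃ : E3} (ε : ℝ)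
    (h : tripleProduct a₁ a₂ a₃ = 0) :
    tripleProduct (ε • (a₁ + ε • (b₁ + ε • r₁))) (ε • (a₂ + ε • (b₂ + ε • r₂)))
      (ε • (a₃ + ε • (b₃ + ε • r₃))) =
    ε ^ 4 * ((tripleProduct b₁ a₂ a₃ + tripleProduct a₁ b₂ a₃ + tripleProduct a₁ a₂ b₃) +
      ε * (tripleProduct r₁ a₂ a₃ + tripleProduct a₁ r₂ a₃ + tripleProduct a₁ a₂ r₃ +
        tripleProduct (b₁ + ε • r₁) (b₂ + ε • r₂) a₃ +
        tripleProduct (b₁ + ε • r₁) a₂ (b₃ + ε • r₃) +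
        tripleProduct a₁ (b₂ + ε • r₂) (b₃ + ε • r₃) +
        ε * tripleProduct (b₁ + ε • r₁) (b₂ + ε • r₂) (b₃ + ε • r₃))) := by
  simp only [tripleProduct_add_left, tripleProduct_add_mid, tripleProduct_add_right,
    tripleProduct_smul_left, tripleProduct_smul_mid, tripleProduct_smul_right, h]
  ring

/-- The leading coefficient of the expansion, for vectors given in a basis adapted to the net. -/
theorem tripleProduct_leading {fu fv fuu fuv fvv : E3} {a b : ℝ} (h : fuv = a • fu + b • fv)
    (x₁ x₂ x₃ y₁ y₂ y₃ l₁ l₂ l₃ m₁ m₂ m₃ n₁ n₂ n₃ : ℝ) :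
    tripleProduct (l₁ • fuu + m₁ • fuv + n₁ • fvv) (x₂ • fu + y₂ • fv) (x₃ • fu + y₃ • fv) +
    tripleProduct (x₁ • fu + y₁ • fv) (l₂ • fuu + m₂ • fuv + n₂ • fvv) (x₃ • fu + y₃ • fv) +
    tripleProduct (x₁ • fu + y₁ • fv) (x₂ • fu + y₂ • fv) (l₃ • fuu + m₃ • fuv + n₃ • fvv) =
    (x₁ * y₂ - x₂ * y₁) * (l₃ * tripleProduct fuu fu fv + n₃ * tripleProduct fvv fu fv) -
    (x₁ * y₃ - x₃ * y₁) * (l₂ * tripleProduct fuu fu fv + n₂ * tripleProduct fvv fu fv) +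
    (x₂ * y₃ - x₃ * y₂) * (l₁ * tripleProduct fuu fu fv + n₁ * tripleProduct fvv fu fv) := by
  subst h
  simp only [tripleProduct_apply, PiLp.add_apply, PiLp.smul_apply, smul_eq_mul]; ring

theorem tripleProduct_span (fu fv : E3) (x₁ x₂ x₃ y₁ y₂ y₃ : ℝ) :
    tripleProduct (x₁ • fu + y₁ • fv) (x₂ • fu + y₂ • fv) (x₃ • fu + y₃ • fv) = 0 := by
  simp only [tripleProduct_apply, PiLp.add_apply, PiLp.smul_apply, smul_eq_mul]; ring

/-! ### Uniform bounds for a net, and planarity of its quadrangles to sixth order -/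

section NetBounds

variable {f : ℝ × ℝ → E3} {f1 : ℝ × ℝ → ℝ × ℝ →L[ℝ] E3}
  {f2 : ℝ × ℝ → ℝ × ℝ →L[ℝ] ℝ × ℝ →L[ℝ] E3}
  {f3 : ℝ × ℝ → ℝ × ℝ →L[ℝ] ℝ × ℝ →L[ℝ] ℝ × ℝ →L[ℝ] E3}
  {f4 : ℝ × ℝ → ℝ × ℝ →L[ℝ] ℝ × ℝ →L[ℝ] ℝ × ℝ →L[ℝ] ℝ × ℝ →L[ℝ] E3}
  {K : Set (ℝ × ℝ)} {ρ B : ℝ}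

/-- Uniform bounds for a net without parabolic points near a set `K` of parameters. -/
structure UniformNetBounds (f : ℝ × ℝ → E3) (f1 : ℝ × ℝ → ℝ × ℝ →L[ℝ] E3)
    (f2 : ℝ × ℝ → ℝ × ℝ →L[ℝ] ℝ × ℝ →L[ℝ] E3)
    (f3 : ℝ × ℝ → ℝ × ℝ →L[ℝ] ℝ × ℝ →L[ℝ] ℝ × ℝ →L[ℝ] E3)
    (f4 : ℝ × ℝ → ℝ × ℝ →L[ℝ] ℝ × ℝ →L[ℝ] ℝ × ℝ →L[ℝ] ℝ × ℝ →L[ℝ] E3)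
    (K : Set (ℝ × ℝ)) (ρ B : ℝ) : Prop where
  tower : ∀ c ∈ K, ∀ m ∈ Metric.closedBall c ρ, HasTower f f1 f2 f3 m ρ
  d3 : ∀ c ∈ K, ∀ x ∈ Metric.closedBall c (2 * ρ), HasFDerivAt f3 (f4 x) x
  b1 : ∀ c ∈ K, ∀ x ∈ Metric.closedBall c (2 * ρ), ‖f1 x‖ ≤ B
  b2 : ∀ c ∈ K, ∀ x ∈ Metric.closedBall c (2 * ρ), ‖f2 x‖ ≤ B
  b3 : ∀ c ∈ K, ∀ x ∈ Metric.closedBall c (2 * ρ), ‖f3 x‖ ≤ B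
  b4 : ∀ c ∈ K, ∀ x ∈ Metric.closedBall c (2 * ρ), ‖f4 x‖ ≤ B
  conj : ∀ c ∈ K, ∀ x ∈ Metric.closedBall c (2 * ρ), ∃ a b : ℝ,
    f2 x (0, 1) (1, 0) = a • f1 x (1, 0) + b • f1 x (0, 1)
  nonparabolic_u : ∀ c ∈ K,
    tripleProduct (f2 c (1, 0) (1, 0)) (f1 c (1, 0)) (f1 c (0, 1)) ≠ 0
  nonparabolic_v : ∀ c ∈ K,
    tripleProduct (f2 c (0, 1) (0, 1)) (f1 c (1, 0)) (f1 c (0, 1)) ≠ 0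
  inv_u : ∀ c ∈ K,
    |(tripleProduct (f2 c (1, 0) (1, 0)) (f1 c (1, 0)) (f1 c (0, 1)))⁻¹| ≤ B
  inv_v : ∀ c ∈ K,
    |(tripleProduct (f2 c (0, 1) (0, 1)) (f1 c (1, 0)) (f1 c (0, 1)))⁻¹| ≤ B

theorem clm_prod_apply {F : Type*} [NormedAddCommGroup F] [NormedSpace ℝ F]
    (l : ℝ × ℝ →L[ℝ] F) (w : ℝ × ℝ) : l w = w.1 • l (1, 0) + w.2 • l (0, 1) := by
  rw [← map_smul, ← map_smul, ← map_add]; simp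

theorem clm_prod_apply₂ {F : Type*} [NormedAddCommGroup F] [NormedSpace ℝ F]
    {l : ℝ × ℝ →L[ℝ] ℝ × ℝ →L[ℝ] F} (h : ∀ x y, l x y = l y x) (w : ℝ × ℝ) :
    l w w = w.1 ^ 2 • l (1, 0) (1, 0) + (2 * w.1 * w.2) • l (0, 1) (1, 0) +
      w.2 ^ 2 • l (0, 1) (0, 1) := by
  rw [clm_prod_apply l w]
  simp only [add_apply, smul_apply]
  rw [clm_prod_apply (l (1, 0)) w, clm_prod_apply (l (0, 1)) w, h (1, 0) (0, 1)]
  module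

/-- The data of one step along a column: base point, mesh, side of the neighbouring column and
direction of the step. -/
structure StepData (K : Set (ℝ × ℝ)) (ρ : ℝ) where
  c : ℝ × ℝ
  ε : ℝ
  σ : ℝ
  τ : ℝ
  mem : c ∈ K
  pos : 0 < ε
  le_one : ε ≤ 1
  le_rad : 2 * ε ≤ ρ
  hσ : σ = 1 ∨ σ = -1
  hτ : τ = 1 ∨ τ = -1

/-- Six times the volume of the tetrahedron spanned by the vertices of a perturbed quadrangle; the
perturbations are measured in units of the mesh. -/
noncomputable def quadVolume (f : ℝ × ℝ → E3) (c : ℝ × ℝ) (ε σ τ : ℝ) (w : (ℝ × ℝ) × (ℝ × ℝ)) : ℝ :=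
  tripleProduct (f (c + ε • (σ, τ)) - f (c + ε • (σ, 0))) (f (c + ε • w.1) - f (c + ε • (σ, 0)))
    (f (c + ε • (w.2 + (0, τ))) - f (c + ε • (σ, 0)))

namespace UniformNetBounds

theorem norm_apply_le (h : UniformNetBounds f f1 f2 f3 f4 K ρ B) {c : ℝ × ℝ} (hc : c ∈ K)
    {x : ℝ × ℝ} (hx : x ∈ Metric.closedBall c (2 * ρ)) {e : ℝ × ℝ} (he : ‖e‖ ≤ 1) :
    ‖f1 x e‖ ≤ B := by
  have hB := h.b1 c hc x hx
  calc _ ≤ ‖f1 x‖ * ‖e‖ := (f1 x).le_opNorm e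
    _ ≤ B * 1 := by gcongr; exact (norm_nonneg _).trans hB
    _ = B := mul_one B

theorem norm_apply_le₂ (h : UniformNetBounds f f1 f2 f3 f4 K ρ B) {c : ℝ × ℝ} (hc : c ∈ K)
    {x : ℝ × ℝ} (hx : x ∈ Metric.closedBall c (2 * ρ)) {e e' : ℝ × ℝ} (he : ‖e‖ ≤ 1)
    (he' : ‖e'‖ ≤ 1) : ‖f2 x e e'‖ ≤ B := by
  have hB := h.b2 c hc x hx
  have hB0 := (norm_nonneg _).trans hB
  calc _ ≤ ‖f2 x‖ * ‖e‖ * ‖e'‖ := (f2 x).le_opNorm₂ e e'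
    _ ≤ B * 1 * 1 := by gcongr
    _ = B := by ring

set_option maxHeartbeats 1000000 in
/-- The quadrangles of the smooth net are planar up to sixth order in the mesh. -/
theorem abs_quadVolume_zero_le (h : UniformNetBounds f f1 f2 f3 f4 K ρ B) (i : StepData K ρ) :
    |quadVolume f i.c i.ε i.σ i.τ 0| ≤ 100 * B ^ 3 * i.ε ^ 6 := by
  obtain ⟨c, ε, σ, τ, hc, hε, h1, hρ, hσ, hτ⟩ := i
  simp only
  -- The expansion is about the centre `m` of the parameter square, whose corners are `m ± z₁` and
  -- `m ± z₂`; a corner would not give the cancellation of odd terms used for `d`.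
  set δ := ε / 2 with hδ
  have hδ0 : 0 < δ := by positivity
  have hδ1 : δ ≤ 1 := by linarith
  have hσ1 : |σ| = 1 := by rcases hσ with h | h <;> simp [h]
  have hτ1 : |τ| = 1 := by rcases hτ with h | h <;> simp [h]
  set m := c + δ • (σ, τ) with hm
  have hz : ∀ s t : ℝ, |s| = 1 → |t| = 1 → ‖δ • (s, t)‖ ≤ δ := fun s t hs ht => by
    simp [Prod.norm_def, hs, ht, abs_of_pos hδ0]
  have hmc : m ∈ Metric.closedBall c ρ := by
    rw [Metric.mem_closedBall, dist_eq_norm, hm, add_sub_cancel_left]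
    exact (hz σ τ hσ1 hτ1).trans (by linarith)
  have hsub : Metric.closedBall m ρ ⊆ Metric.closedBall c (2 * ρ) :=
    Metric.closedBall_subset_closedBall' (by rw [Metric.mem_closedBall] at hmc; linarith)
  have hmm : m ∈ Metric.closedBall c (2 * ρ) :=
    hsub (Metric.mem_closedBall_self (by linarith))
  have hT := h.tower c hc m hmc
  have hδρ : δ ≤ ρ := by linarith
  have hB0 : 0 ≤ B := (norm_nonneg _).trans (h.b1 c hc m hmm)
  have hr : ∀ z : ℝ × ℝ, ‖z‖ ≤ δ → ‖taylorRem f (f1 m) (f2 m) m z‖ ≤ B * δ ^ 3 := fun z hz =>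
    hT.norm_taylorRem_le (fun x hx => h.b3 c hc x (hsub hx)) hδρ hz
  have hg : ∀ z : ℝ × ℝ, ‖z‖ ≤ δ →
      ‖f (m + z) + f (m - z) - (2 : ℝ) • f m - f2 m z z‖ ≤ 2 * B * δ ^ 4 := fun z hz =>
    hT.norm_even_part_le (fun x hx => h.d3 c hc x (hsub hx)) (fun x hx => h.b4 c hc x (hsub hx))
      hδρ hz
  have hf : ∀ z, f (m + z) = f m + f1 m z + (1 / 2 : ℝ) • f2 m z z +
      taylorRem f (f1 m) (f2 m) m z := fun z => by unfold taylorRem; abel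
  set fu := f1 m (1, 0) with hfu
  set fv := f1 m (0, 1) with hfv
  set fuv := f2 m (0, 1) (1, 0) with hfuv
  obtain ⟨a, b, hab⟩ := h.conj c hc m hmm
  replace hab : fuv = a • fu + b • fv := hab
  have nu : ‖fu‖ ≤ B := h.norm_apply_le hc hmm (by simp [Prod.norm_def])
  have nv : ‖fv‖ ≤ B := h.norm_apply_le hc hmm (by simp [Prod.norm_def])
  have nuv : ‖fuv‖ ≤ B := h.norm_apply_le₂ hc hmm (by simp [Prod.norm_def]) (by simp [Prod.norm_def])
  set z₁ : ℝ × ℝ := δ • (σ, τ) with hz₁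
  set z₂ : ℝ × ℝ := δ • (σ, -τ) with hz₂
  have n₁ : ‖z₁‖ ≤ δ := hz _ _ hσ1 hτ1
  have n₂ : ‖z₂‖ ≤ δ := hz _ _ hσ1 (by simpa using hτ1)
  have q₁ := clm_prod_apply₂ hT.symm z₁
  have q₂ := clm_prod_apply₂ hT.symm z₂
  have l₁ := clm_prod_apply (f1 m) z₁
  have l₂ := clm_prod_apply (f1 m) z₂
  simp only [hz₁, hz₂, Prod.smul_mk, smul_eq_mul, ← hfu, ← hfv, ← hfuv] at q₁ q₂ l₁ l₂
  have eP1 : c + ε • (σ, τ) = m + z₁ := by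
    rw [hm, hz₁, hδ]
    ext <;> simp <;> ring
  have eP0 : c + ε • (σ, (0 : ℝ)) = m + z₂ := by
    rw [hm, hz₁, hz₂, hδ]
    ext <;> simp <;> ring
  have eQ0 : c + ε • (0 : (ℝ × ℝ) × (ℝ × ℝ)).1 = m - z₁ := by
    simp [hm, hz₁]
  have eQ1 : c + ε • ((0 : (ℝ × ℝ) × (ℝ × ℝ)).2 + (0, τ)) = m - z₂ := by
    rw [hm, hz₁, hz₂, hδ]
    ext <;> simp; ring
  set x := f (m + z₁) - f (m + z₂) with hx
  set y := f (m - z₁) - f (m + z₂) with hy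
  -- The third edge vector is `x + y - d`, so in the triple product it may be replaced by `-d`. This
  -- mixed second difference contains only even parts of `f` about `m`, hence equals `d'` up to
  -- order four.
  set d := f (m + z₁) + f (m - z₁) - f (m + z₂) - f (m - z₂) with hd
  set x' := (2 * τ * δ) • fv + (2 * σ * τ * δ ^ 2) • fuv with hx'
  set y' := (-(2 * σ * δ)) • fu + (2 * σ * τ * δ ^ 2) • fuv with hy'
  set d' := (4 * σ * τ * δ ^ 2) • fuv with hd'
  have hxx : ‖x - x'‖ ≤ 2 * B * δ ^ 3 := by
    have e : x - x' = taylorRem f (f1 m) (f2 m) m z₁ - taylorRem f (f1 m) (f2 m) m z₂ := by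
      rw [hx, hx', hf z₁, hf z₂, hz₁, hz₂]
      simp only [Prod.smul_mk, smul_eq_mul, q₁, q₂, l₁, l₂]
      module
    rw [e]
    exact (norm_sub_le _ _).trans (by linarith [hr z₁ n₁, hr z₂ n₂])
  have hyy : ‖y - y'‖ ≤ 2 * B * δ ^ 3 := by
    have e : y - y' = taylorRem f (f1 m) (f2 m) m (-z₁) - taylorRem f (f1 m) (f2 m) m z₂ := by
      rw [hy, hy', sub_eq_add_neg m z₁, hf (-z₁), hf z₂]
      simp only [map_neg, neg_apply, neg_neg]
      rw [hz₁, hz₂]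
      simp only [Prod.smul_mk, smul_eq_mul, q₁, q₂, l₁, l₂]
      module
    rw [e]
    exact (norm_sub_le _ _).trans (by linarith [hr (-z₁) (by simpa using n₁), hr z₂ n₂])
  have hdd : ‖d - d'‖ ≤ 4 * B * δ ^ 4 := by
    have e : d - d' = (f (m + z₁) + f (m - z₁) - (2 : ℝ) • f m - f2 m z₁ z₁) -
        (f (m + z₂) + f (m - z₂) - (2 : ℝ) • f m - f2 m z₂ z₂) := by
      have : f2 m z₁ z₁ - f2 m z₂ z₂ = d' := by
        rw [hz₁, hz₂]
        simp only [Prod.smul_mk, smul_eq_mul, q₁, q₂]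
        module
      rw [← this, hd]
      abel
    rw [e]
    exact (norm_sub_le _ _).trans (by linarith [hg z₁ n₁, hg z₂ n₂])
  have p1 : δ ^ 2 ≤ δ := by nlinarith
  have p2 : δ ^ 3 ≤ δ := by nlinarith
  have p3 : δ ^ 4 ≤ δ ^ 2 := by nlinarith
  have bx' : ‖x'‖ ≤ 4 * B * δ := by
    calc _ ≤ |2 * τ * δ| * ‖fv‖ + |2 * σ * τ * δ ^ 2| * ‖fuv‖ := by
          refine (norm_add_le _ _).trans ?_
          rw [norm_smul, norm_smul, Real.norm_eq_abs, Real.norm_eq_abs]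
      _ = 2 * δ * ‖fv‖ + 2 * δ ^ 2 * ‖fuv‖ := by
          simp [abs_mul, hσ1, hτ1, abs_of_pos hδ0]
      _ ≤ 2 * δ * B + 2 * δ * B := by gcongr
      _ = _ := by ring
  have by' : ‖y'‖ ≤ 4 * B * δ := by
    calc _ ≤ |-(2 * σ * δ)| * ‖fu‖ + |2 * σ * τ * δ ^ 2| * ‖fuv‖ := by
          refine (norm_add_le _ _).trans ?_
          rw [norm_smul, norm_smul, Real.norm_eq_abs, Real.norm_eq_abs]
      _ = 2 * δ * ‖fu‖ + 2 * δ ^ 2 * ‖fuv‖ := by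
          simp [abs_mul, hσ1, hτ1, abs_of_pos hδ0]
      _ ≤ 2 * δ * B + 2 * δ * B := by gcongr
      _ = _ := by ring
  have bd' : ‖d'‖ ≤ 4 * B * δ ^ 2 := by
    rw [hd', norm_smul, Real.norm_eq_abs]
    simp only [abs_mul, hσ1, hτ1, abs_of_pos hδ0, abs_pow]
    norm_num
    nlinarith [sq_nonneg δ]
  have b3 : B * δ ^ 3 ≤ B * δ := by gcongr
  have b4 : B * δ ^ 4 ≤ B * δ ^ 2 := by gcongr
  have bBδ : 0 ≤ B * δ := by positivity
  have bx : ‖x‖ ≤ 6 * B * δ := by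
    have : ‖x‖ ≤ ‖x - x'‖ + ‖x'‖ := by simpa using norm_add_le (x - x') x'
    linarith
  have hby : ‖y‖ ≤ 6 * B * δ := by
    have : ‖y‖ ≤ ‖y - y'‖ + ‖y'‖ := by simpa using norm_add_le (y - y') y'
    linarith
  have bd : ‖d‖ ≤ 8 * B * δ ^ 2 := by
    have : ‖d‖ ≤ ‖d - d'‖ + ‖d'‖ := by simpa using norm_add_le (d - d') d'
    linarith
  -- Conjugacy enters here: `fuv` is tangent, so `x'`, `y'`, `d'` all lie in the span of `fu` and
  -- `fv`.
  have h0 : tripleProduct x' y' d' = 0 := by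
    simp only [hx', hy', hd', hab, tripleProduct_apply, PiLp.add_apply, PiLp.smul_apply,
      smul_eq_mul]
    ring
  have key := abs_tripleProduct_le_of_near h0 bx hby (bx'.trans (by linarith)) bd
    (by'.trans (by linarith)) hxx hyy hdd
  have eV : quadVolume f c ε σ τ 0 = -tripleProduct x y d := by
    rw [quadVolume, eP1, eP0, eQ0, eQ1]
    simp only [hx, hy, hd, tripleProduct_apply, PiLp.add_apply, PiLp.sub_apply]
    ring
  rw [eV, abs_neg]
  -- `12 * 2 * 6 * 8 + 6 * 6 ^ 2 * 4 = 2016`, and `δ = ε / 2` contributes `1 / 2 ^ 6`.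
  refine key.trans (le_of_eq_of_le (b := 2016 / 64 * B ^ 3 * ε ^ 6) ?_ ?_)
  · rw [hδ]; ring
  · gcongr; norm_num

end UniformNetBounds
end NetBounds

/-! ### Comparison of the volume with the quadric model -/

section Expansion

variable {f : ℝ × ℝ → E3} {f1 : ℝ × ℝ → ℝ × ℝ →L[ℝ] E3}
  {f2 : ℝ × ℝ → ℝ × ℝ →L[ℝ] ℝ × ℝ →L[ℝ] E3}
  {f3 : ℝ × ℝ → ℝ × ℝ →L[ℝ] ℝ × ℝ →L[ℝ] ℝ × ℝ →L[ℝ] E3}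
  {f4 : ℝ × ℝ → ℝ × ℝ →L[ℝ] ℝ × ℝ →L[ℝ] ℝ × ℝ →L[ℝ] ℝ × ℝ →L[ℝ] E3}
  {K : Set (ℝ × ℝ)} {ρ B : ℝ}

/-- The volume `quadVolume` in the case of the quadric `z = (L u² + N v²) / 2` and unit mesh. -/
noncomputable def quadModel (L N σ τ : ℝ) (w : (ℝ × ℝ) × (ℝ × ℝ)) : ℝ :=
  -((w.1.1 - σ) * τ) * ((w.2.1 ^ 2 - σ ^ 2) / 2 * L + (w.2.2 + τ) ^ 2 / 2 * N) +
    (w.2.1 - σ) * τ * ((w.1.1 ^ 2 - σ ^ 2) / 2 * L + w.1.2 ^ 2 / 2 * N) +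
    ((w.1.1 - σ) * (w.2.2 + τ) - (w.2.1 - σ) * w.1.2) * (τ ^ 2 / 2 * N)

/-- The first of the two nonzero second order coefficients of a net at a point. -/
noncomputable def coeffU (f1 : ℝ × ℝ → ℝ × ℝ →L[ℝ] E3)
    (f2 : ℝ × ℝ → ℝ × ℝ →L[ℝ] ℝ × ℝ →L[ℝ] E3) (c : ℝ × ℝ) : ℝ :=
  tripleProduct (f2 c (1, 0) (1, 0)) (f1 c (1, 0)) (f1 c (0, 1))

/-- The second of the two nonzero second order coefficients of a net at a point. -/
noncomputable def coeffV (f1 : ℝ × ℝ → ℝ × ℝ →L[ℝ] E3)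
    (f2 : ℝ × ℝ → ℝ × ℝ →L[ℝ] ℝ × ℝ →L[ℝ] E3) (c : ℝ × ℝ) : ℝ :=
  tripleProduct (f2 c (0, 1) (0, 1)) (f1 c (1, 0)) (f1 c (0, 1))

/-- The linear part of a net at `c`. -/
noncomputable def netLin (f1 : ℝ × ℝ → ℝ × ℝ →L[ℝ] E3) (c w : ℝ × ℝ) : E3 :=
  w.1 • f1 c (1, 0) + w.2 • f1 c (0, 1)

/-- The quadratic part of a net at `c`. -/
noncomputable def netQuad (f2 : ℝ × ℝ → ℝ × ℝ →L[ℝ] ℝ × ℝ →L[ℝ] E3) (c w : ℝ × ℝ) : E3 :=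
  (w.1 * w.1 * (1 / 2 : ℝ)) • f2 c (1, 0) (1, 0) + (w.1 * w.2) • f2 c (0, 1) (1, 0) +
    (w.2 * w.2 * (1 / 2 : ℝ)) • f2 c (0, 1) (0, 1)

theorem netLin_sub (c w w' : ℝ × ℝ) : netLin f1 c w - netLin f1 c w' =
    (w.1 - w'.1) • f1 c (1, 0) + (w.2 - w'.2) • f1 c (0, 1) := by
  simp only [netLin]; module

theorem netQuad_sub (c w w' : ℝ × ℝ) : netQuad f2 c w - netQuad f2 c w' =
    ((w.1 * w.1 - w'.1 * w'.1) / 2) • f2 c (1, 0) (1, 0) +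
      (w.1 * w.2 - w'.1 * w'.2) • f2 c (0, 1) (1, 0) +
      ((w.2 * w.2 - w'.2 * w'.2) / 2) • f2 c (0, 1) (0, 1) := by
  simp only [netQuad]; module

/-- Linear parts lie in the span of two vectors; this removes the term of order `ε³` from the
volume. -/
theorem tripleProduct_netLin (c p₀ p₁ p₂ p₃ : ℝ × ℝ) :
    tripleProduct (netLin f1 c p₁ - netLin f1 c p₀) (netLin f1 c p₂ - netLin f1 c p₀)
      (netLin f1 c p₃ - netLin f1 c p₀) = 0 := by
  simp only [netLin_sub, tripleProduct_span]

/-- This is the coefficient of `ε⁴` in the volume. The mixed derivative is tangent and drops out, so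
the model quadric has no `u v` term. -/
theorem tripleProduct_netQuad {c : ℝ × ℝ} {a b : ℝ}
    (h : f2 c (0, 1) (1, 0) = a • f1 c (1, 0) + b • f1 c (0, 1)) (σ τ : ℝ)
    (w : (ℝ × ℝ) × (ℝ × ℝ)) :
    tripleProduct (netQuad f2 c (σ, τ) - netQuad f2 c (σ, 0))
      (netLin f1 c w.1 - netLin f1 c (σ, 0)) (netLin f1 c (w.2 + (0, τ)) - netLin f1 c (σ, 0)) +
    tripleProduct (netLin f1 c (σ, τ) - netLin f1 c (σ, 0))
      (netQuad f2 c w.1 - netQuad f2 c (σ, 0)) (netLin f1 c (w.2 + (0, τ)) - netLin f1 c (σ, 0)) +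
    tripleProduct (netLin f1 c (σ, τ) - netLin f1 c (σ, 0))
      (netLin f1 c w.1 - netLin f1 c (σ, 0)) (netQuad f2 c (w.2 + (0, τ)) - netQuad f2 c (σ, 0)) =
    quadModel (coeffU f1 f2 c) (coeffV f1 f2 c) σ τ w := by
  simp only [netLin_sub, netQuad_sub, tripleProduct_leading h, quadModel, coeffU, coeffV,
    Prod.fst_add, Prod.snd_add]
  ring

/-- The ball of radius `2` contains all rescaled vertices: lattice offsets have norm at most `1`,
and so have the admitted perturbations. -/
theorem uniformlyBoundedLipschitz_fst {ι : Type*} :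
    UniformlyBoundedLipschitz (fun (_ : ι) (w : ℝ × ℝ) => w.1) (Metric.closedBall 0 2) := by
  refine ⟨2, fun _ w hw => ⟨(norm_fst_le w).trans (by simpa using hw), fun w' _ => ?_⟩⟩
  rw [dist_eq_norm]
  have := norm_fst_le (w - w')
  simp only [Prod.fst_sub] at this
  linarith [norm_nonneg (w - w')]

theorem uniformlyBoundedLipschitz_snd {ι : Type*} :
    UniformlyBoundedLipschitz (fun (_ : ι) (w : ℝ × ℝ) => w.2) (Metric.closedBall 0 2) := by
  refine ⟨2, fun _ w hw => ⟨(norm_snd_le w).trans (by simpa using hw), fun w' _ => ?_⟩⟩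
  rw [dist_eq_norm]
  have := norm_snd_le (w - w')
  simp only [Prod.snd_sub] at this
  linarith [norm_nonneg (w - w')]

/-- The cubic Taylor remainder in rescaled coordinates. -/
noncomputable def scaledRem (f : ℝ × ℝ → E3) (f1 : ℝ × ℝ → ℝ × ℝ →L[ℝ] E3)
    (f2 : ℝ × ℝ → ℝ × ℝ →L[ℝ] ℝ × ℝ →L[ℝ] E3) (i : StepData K ρ) (w : ℝ × ℝ) : E3 :=
  (i.ε ^ 3)⁻¹ • taylorRem f (f1 i.c) (f2 i.c) i.c (i.ε • w)

namespace UniformNetBounds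

theorem base_mem (i : StepData K ρ) : i.c ∈ Metric.closedBall i.c (2 * ρ) :=
  Metric.mem_closedBall_self (by linarith [i.pos, i.le_rad])

/-- On vectors of size `2ε` the remainder is at most `8 B ε³` and has Lipschitz constant `4 B ε²`;
the rescaling cancels every power of `ε`. -/
theorem scaledRem_lipschitz (h : UniformNetBounds f f1 f2 f3 f4 K ρ B) :
    UniformlyBoundedLipschitz (scaledRem f f1 f2 (K := K) (ρ := ρ)) (Metric.closedBall 0 2) := by
  refine ⟨8 * B, fun i w hw => ?_⟩
  have hε := i.pos
  have hB0 : 0 ≤ B := (norm_nonneg _).trans (h.b1 _ i.mem _ (base_mem i))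
  have hball : Metric.closedBall i.c ρ ⊆ Metric.closedBall i.c (2 * ρ) :=
    Metric.closedBall_subset_closedBall (by linarith [i.le_rad])
  have hT := h.tower _ i.mem i.c (Metric.mem_closedBall_self (by linarith [i.le_rad]))
  have hs : ∀ w : ℝ × ℝ, w ∈ Metric.closedBall 0 2 → ‖i.ε • w‖ ≤ 2 * i.ε := fun w hw => by
    rw [norm_smul, Real.norm_eq_abs, abs_of_pos hε, mul_comm]
    gcongr
    simpa using hw
  have hε3 : ‖(i.ε ^ 3)⁻¹‖ = (i.ε ^ 3)⁻¹ := by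
    rw [Real.norm_eq_abs, abs_of_pos (by positivity)]
  refine ⟨?_, fun w' hw' => ?_⟩
  · rw [scaledRem, norm_smul, hε3]
    calc _ ≤ (i.ε ^ 3)⁻¹ * (B * (2 * i.ε) ^ 3) := by
          gcongr
          exact hT.norm_taylorRem_le (fun x hx => h.b3 _ i.mem x (hball hx)) i.le_rad (hs w hw)
      _ = _ := by field_simp; ring
  · rw [scaledRem, scaledRem, ← smul_sub, norm_smul, hε3, dist_eq_norm]
    calc _ ≤ (i.ε ^ 3)⁻¹ * (B * (2 * i.ε) ^ 2 * ‖i.ε • w - i.ε • w'‖) := by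
          gcongr
          exact hT.taylorRem_lipschitz (fun x hx => h.b3 _ i.mem x (hball hx)) i.le_rad
            (hs w hw) (hs w' hw')
      _ = 4 * B * ‖w - w'‖ := by
          rw [← smul_sub, norm_smul, Real.norm_eq_abs, abs_of_pos hε]
          field_simp; ring
      _ ≤ 8 * B * ‖w - w'‖ := by gcongr; norm_num

theorem linear_lipschitz (h : UniformNetBounds f f1 f2 f3 f4 K ρ B) :
    UniformlyBoundedLipschitz (fun (i : StepData K ρ) (w : ℝ × ℝ) =>
      netLin f1 i.c w) (Metric.closedBall 0 2) :=
  (uniformlyBoundedLipschitz_fst.smul (.const fun i : StepData K ρ =>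
      h.norm_apply_le i.mem (base_mem i) (by simp [Prod.norm_def]))).add
    (uniformlyBoundedLipschitz_snd.smul (.const fun i : StepData K ρ =>
      h.norm_apply_le i.mem (base_mem i) (by simp [Prod.norm_def])))

theorem quadratic_lipschitz (h : UniformNetBounds f f1 f2 f3 f4 K ρ B) :
    UniformlyBoundedLipschitz (fun (i : StepData K ρ) (w : ℝ × ℝ) =>
      netQuad f2 i.c w) (Metric.closedBall 0 2) := by
  have hh : UniformlyBoundedLipschitz (fun (_ : StepData K ρ) (_ : ℝ × ℝ) => (1 / 2 : ℝ))
      (Metric.closedBall 0 2) := .const (C := 1 / 2) fun _ => by norm_num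
  have hx := uniformlyBoundedLipschitz_fst (ι := StepData K ρ)
  have hy := uniformlyBoundedLipschitz_snd (ι := StepData K ρ)
  exact ((((hx.mul hx).mul hh).smul (.const fun i : StepData K ρ =>
      h.norm_apply_le₂ i.mem (base_mem i) (by simp [Prod.norm_def]) (by simp [Prod.norm_def]))).add
    ((hx.mul hy).smul (.const fun i : StepData K ρ =>
      h.norm_apply_le₂ i.mem (base_mem i) (by simp [Prod.norm_def]) (by simp [Prod.norm_def])))).add
    (((hy.mul hy).mul hh).smul (.const fun i : StepData K ρ =>
      h.norm_apply_le₂ i.mem (base_mem i) (by simp [Prod.norm_def]) (by simp [Prod.norm_def])))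

/-- Differences between the values at the vertices of a quadrangle of a family of maps. -/
theorem vertex_sub_lipschitz {g : StepData K ρ → ℝ × ℝ → E3}
    (hg : UniformlyBoundedLipschitz g (Metric.closedBall 0 2)) :
    UniformlyBoundedLipschitz (fun i (_ : (ℝ × ℝ) × (ℝ × ℝ)) => g i (i.σ, i.τ) - g i (i.σ, 0))
      (Metric.closedBall 0 1) ∧
    UniformlyBoundedLipschitz (fun i (w : (ℝ × ℝ) × (ℝ × ℝ)) => g i w.1 - g i (i.σ, 0))
      (Metric.closedBall 0 1) ∧
    UniformlyBoundedLipschitz (fun i (w : (ℝ × ℝ) × (ℝ × ℝ)) => g i (w.2 + (0, i.τ)) - g i (i.σ, 0))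
      (Metric.closedBall 0 1) := by
  have hσ : ∀ i : StepData K ρ, |i.σ| = 1 := fun i => by rcases i.hσ with h | h <;> simp [h]
  have hτ : ∀ i : StepData K ρ, |i.τ| = 1 := fun i => by rcases i.hτ with h | h <;> simp [h]
  have h0 := hg.comp (t := Metric.closedBall (0 : (ℝ × ℝ) × (ℝ × ℝ)) 1) (φ := fun i _ => (i.σ, 0))
    (fun i w _ => by simp [Prod.norm_def, hσ i]) (by simp)
  have h1 := hg.comp (t := Metric.closedBall (0 : (ℝ × ℝ) × (ℝ × ℝ)) 1)
    (φ := fun i _ => (i.σ, i.τ))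
    (fun i w _ => by simp [Prod.norm_def, hσ i, hτ i]) (by simp)
  have h2 := hg.comp (t := Metric.closedBall (0 : (ℝ × ℝ) × (ℝ × ℝ)) 1) (φ := fun i w => w.1)
    (fun i w hw => by
      simp only [Metric.mem_closedBall, dist_zero_right] at hw ⊢
      linarith [norm_fst_le w])
    (fun i w w' => by rw [Prod.dist_eq]; exact le_max_left _ _)
  have h3 := hg.comp (t := Metric.closedBall (0 : (ℝ × ℝ) × (ℝ × ℝ)) 1)
    (φ := fun i w => w.2 + (0, i.τ))
    (fun i w hw => by
      simp only [Metric.mem_closedBall, dist_zero_right] at hw ⊢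
      have : ‖((0 : ℝ), i.τ)‖ ≤ 1 := by simp [Prod.norm_def, hτ i]
      linarith [norm_snd_le w, norm_add_le w.2 (0, i.τ)])
    (fun i w w' => by rw [dist_add_right, Prod.dist_eq]; exact le_max_right _ _)
  exact ⟨h1.sub h0, h2.sub h0, h3.sub h0⟩

theorem apply_scaled (h : UniformNetBounds f f1 f2 f3 f4 K ρ B) (i : StepData K ρ) (w : ℝ × ℝ) :
    f (i.c + i.ε • w) = f i.c + i.ε • (netLin f1 i.c w + i.ε •
      (netQuad f2 i.c w + i.ε • scaledRem f f1 f2 i w)) := by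
  have hε := i.pos
  have hT := h.tower _ i.mem i.c (Metric.mem_closedBall_self (by linarith [i.le_rad]))
  have e1 : taylorRem f (f1 i.c) (f2 i.c) i.c (i.ε • w) = i.ε ^ 3 • scaledRem f f1 f2 i w := by
    rw [scaledRem, smul_inv_smul₀ (by positivity)]
  have e2 : f (i.c + i.ε • w) = f i.c + f1 i.c (i.ε • w) +
      (1 / 2 : ℝ) • f2 i.c (i.ε • w) (i.ε • w) +
      taylorRem f (f1 i.c) (f2 i.c) i.c (i.ε • w) := by unfold taylorRem; abel
  rw [e2, e1, clm_prod_apply (f1 i.c) (i.ε • w), clm_prod_apply₂ hT.symm (i.ε • w), netLin, netQuad]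
  simp only [Prod.smul_fst, Prod.smul_snd, smul_eq_mul]
  module

/-- The volume of a perturbed quadrangle is that of the quadric model up to a small perturbation. -/
theorem exists_expansion (h : UniformNetBounds f f1 f2 f3 f4 K ρ B) :
    ∃ S : StepData K ρ → (ℝ × ℝ) × (ℝ × ℝ) → ℝ,
      UniformlyBoundedLipschitz S (Metric.closedBall 0 1) ∧
      ∀ i w, quadVolume f i.c i.ε i.σ i.τ w =
        i.ε ^ 4 * (quadModel (coeffU f1 f2 i.c) (coeffV f1 f2 i.c) i.σ i.τ w + i.ε * S i w) := by
  obtain ⟨a1, a2, a3⟩ := vertex_sub_lipschitz h.linear_lipschitz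
  obtain ⟨b1, b2, b3⟩ := vertex_sub_lipschitz h.quadratic_lipschitz
  obtain ⟨r1, r2, r3⟩ := vertex_sub_lipschitz h.scaledRem_lipschitz
  have he : UniformlyBoundedLipschitz (fun (i : StepData K ρ) (_ : (ℝ × ℝ) × (ℝ × ℝ)) => i.ε)
      (Metric.closedBall 0 1) := .const (C := 1) fun i => by
    rw [Real.norm_eq_abs, abs_of_pos i.pos]; exact i.le_one
  have e1 := b1.add (he.smul r1)
  have e2 := b2.add (he.smul r2)
  have e3 := b3.add (he.smul r3)
  -- `S` is the factor of the inner `ε` in `tripleProduct_expansion`, read off by unification from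
  -- the proof that it is bounded and Lipschitz.
  refine ⟨_, ((((((r1.tripleProduct a2 a3).add (a1.tripleProduct r2 a3)).add
    (a1.tripleProduct a2 r3)).add (e1.tripleProduct e2 a3)).add (e1.tripleProduct a2 e3)).add
    (a1.tripleProduct e2 e3)).add (he.mul (e1.tripleProduct e2 e3)), fun i w => ?_⟩
  obtain ⟨a, b, hab⟩ := h.conj _ i.mem _ (base_mem i)
  rw [quadVolume, h.apply_scaled i (i.σ, i.τ), h.apply_scaled i (i.σ, 0), h.apply_scaled i w.1,
    h.apply_scaled i (w.2 + (0, i.τ)), ← tripleProduct_netQuad hab]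
  refine Eq.trans ?_ (tripleProduct_expansion i.ε
    (tripleProduct_netLin i.c (i.σ, 0) (i.σ, i.τ) w.1 (w.2 + (0, i.τ))))
  congr 1 <;> module

end UniformNetBounds
end Expansion

/-! ### Solving for the next vertex of a column -/

section Step

variable {f : ℝ × ℝ → E3} {f1 : ℝ × ℝ → ℝ × ℝ →L[ℝ] E3}
  {f2 : ℝ × ℝ → ℝ × ℝ →L[ℝ] ℝ × ℝ →L[ℝ] E3}
  {f3 : ℝ × ℝ → ℝ × ℝ →L[ℝ] ℝ × ℝ →L[ℝ] ℝ × ℝ →L[ℝ] E3}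
  {f4 : ℝ × ℝ → ℝ × ℝ →L[ℝ] ℝ × ℝ →L[ℝ] ℝ × ℝ →L[ℝ] ℝ × ℝ →L[ℝ] E3}
  {K : Set (ℝ × ℝ)} {ρ B : ℝ}

/-- The nonlinear part of the quadric model near its exact solution, the reflection of `w`. -/
noncomputable def quadModelErr (L N σ τ : ℝ) (w z : ℝ × ℝ) : ℝ :=
  quadModel L N σ τ (w, (w.1, -w.2) + z) - (-(τ * L / 2) * z.1 + σ * N / 2 * z.2)

/-- On the quadric a chord joining points with equal `u` and with `v`-coordinates `v₁`, `v₂` has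
direction `(0, 1, N (v₁ + v₂) / 2)`. Both the fixed edge and the reflected one have `v₁ + v₂ = τ`,
so they are parallel and the quadrangle is a planar trapezoid. -/
theorem quadModelErr_zero (L N σ τ : ℝ) (hτ : τ = 1 ∨ τ = -1) (w : ℝ × ℝ) :
    quadModelErr L N σ τ w 0 = 0 := by
  rcases hτ with rfl | rfl <;> simp [quadModelErr, quadModel] <;> ring

/-- The linear form subtracted in `quadModelErr` is the differential in `z` at `w = z = 0`, so the
remaining gradient is of the order of `‖w‖` and `‖z‖`. -/
theorem abs_quadModelErr_sub_le (L N : ℝ) {σ τ r : ℝ} (hσ : σ = 1 ∨ σ = -1) (hτ : τ = 1 ∨ τ = -1)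
    (hr : r ≤ 1) {w z z' : ℝ × ℝ} (hw : ‖w‖ ≤ r) (hz : ‖z‖ ≤ r) (hz' : ‖z'‖ ≤ r) :
    |quadModelErr L N σ τ w z - quadModelErr L N σ τ w z'| ≤
      20 * (|L| + |N|) * r * ‖z - z'‖ := by
  have hr0 : 0 ≤ r := (norm_nonneg _).trans hw
  have hσ1 : |σ| = 1 := by rcases hσ with h | h <;> simp [h]
  have hτ1 : |τ| = 1 := by rcases hτ with h | h <;> simp [h]
  obtain ⟨x, y⟩ := w
  obtain ⟨p, q⟩ := z
  obtain ⟨p', q'⟩ := z'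
  have hx : |x| ≤ r := (norm_fst_le (x, y)).trans hw
  have hy : |y| ≤ r := (norm_snd_le (x, y)).trans hw
  have hp : |p| ≤ r := (norm_fst_le (p, q)).trans hz
  have hq : |q| ≤ r := (norm_snd_le (p, q)).trans hz
  have hp' : |p'| ≤ r := (norm_fst_le (p', q')).trans hz'
  have hq' : |q'| ≤ r := (norm_snd_le (p', q')).trans hz'
  have dp : |p - p'| ≤ ‖(p, q) - (p', q')‖ := norm_fst_le ((p, q) - (p', q'))
  have dq : |q - q'| ≤ ‖(p, q) - (p', q')‖ := norm_snd_le ((p, q) - (p', q'))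
  set D := ‖(p, q) - (p', q')‖
  have e : quadModelErr L N σ τ (x, y) (p, q) - quadModelErr L N σ τ (x, y) (p', q') =
      (p - p') * (-τ * (x - σ) * L * (x + (p + p') / 2) + τ * (L * (x * x) + N * (y * y)) / 2 -
        N * y / 2) +
      (q - q') * (-(N * x / 2) - τ * (x - σ) * (N / 2) * (q + q' - 2 * y)) := by
    rcases hσ with rfl | rfl <;> rcases hτ with rfl | rfl <;>
      simp only [quadModelErr, quadModel, Prod.fst_add, Prod.snd_add] <;> ring
  have hxσ : |x - σ| ≤ 2 := (abs_sub _ _).trans (by rw [hσ1]; linarith)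
  have h1 : |x + (p + p') / 2| ≤ 2 * r := by
    rw [abs_le] at *; constructor <;> linarith [hx.1, hx.2, hp.1, hp.2, hp'.1, hp'.2]
  have h2 : |q + q' - 2 * y| ≤ 4 * r := by
    rw [abs_le] at *; constructor <;> linarith [hy.1, hy.2, hq.1, hq.2, hq'.1, hq'.2]
  have hxx : |x| * |x| ≤ r * 1 := by gcongr; exact hx.trans hr
  have hyy : |y| * |y| ≤ r * 1 := by gcongr; exact hy.trans hr
  have hL := abs_nonneg L
  have hN := abs_nonneg N
  have G1 : |-τ * (x - σ) * L * (x + (p + p') / 2) + τ * (L * (x * x) + N * (y * y)) / 2 -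
        N * y / 2| ≤ (5 * |L| + |N|) * r := by
    calc _ ≤ |-τ * (x - σ) * L * (x + (p + p') / 2)| +
          |τ * (L * (x * x) + N * (y * y)) / 2| + |N * y / 2| :=
          (abs_sub _ _).trans (by gcongr; exact abs_add_le _ _)
      _ = |x - σ| * |L| * |x + (p + p') / 2| + |L * (x * x) + N * (y * y)| / 2 + |N| * |y| / 2 := by
          simp only [abs_mul, abs_neg, abs_div, hτ1, abs_two, one_mul]
      _ ≤ 2 * |L| * (2 * r) + (|L| * (r * 1) + |N| * (r * 1)) / 2 + |N| * r / 2 := by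
          gcongr
          refine (abs_add_le _ _).trans ?_
          rw [abs_mul, abs_mul, abs_mul, abs_mul]
          gcongr
      _ ≤ _ := by nlinarith [mul_nonneg hL hr0, mul_nonneg hN hr0]
  have G2 : |-(N * x / 2) - τ * (x - σ) * (N / 2) * (q + q' - 2 * y)| ≤ 5 * |N| * r := by
    calc _ ≤ |-(N * x / 2)| + |τ * (x - σ) * (N / 2) * (q + q' - 2 * y)| := abs_sub _ _
      _ = |N| * |x| / 2 + |x - σ| * (|N| / 2) * |q + q' - 2 * y| := by
          simp only [abs_mul, abs_neg, abs_div, hτ1, abs_two, one_mul]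
      _ ≤ |N| * r / 2 + 2 * (|N| / 2) * (4 * r) := by gcongr
      _ ≤ _ := by nlinarith [mul_nonneg hN hr0]
  rw [e]
  refine (abs_add_le _ _).trans ?_
  rw [abs_mul, abs_mul]
  calc _ ≤ D * ((5 * |L| + |N|) * r) + D * (5 * |N| * r) := by gcongr
    _ ≤ _ := by
      have hD : 0 ≤ D := norm_nonneg _
      nlinarith [mul_nonneg (mul_nonneg hL hr0) hD, mul_nonneg (mul_nonneg hN hr0) hD]

namespace UniformNetBounds

theorem abs_coeffU_le (h : UniformNetBounds f f1 f2 f3 f4 K ρ B) (i : StepData K ρ) :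
    |coeffU f1 f2 i.c| ≤ 6 * B ^ 3 := by
  have hB0 : 0 ≤ B := (norm_nonneg _).trans (h.b1 _ i.mem _ (base_mem i))
  calc _ ≤ _ := abs_tripleProduct_le _ _ _
    _ ≤ 6 * B * B * B := by
      gcongr
      · exact h.norm_apply_le₂ i.mem (base_mem i) (by simp [Prod.norm_def]) (by simp [Prod.norm_def])
      · exact h.norm_apply_le i.mem (base_mem i) (by simp [Prod.norm_def])
      · exact h.norm_apply_le i.mem (base_mem i) (by simp [Prod.norm_def])
    _ = _ := by ring

theorem abs_coeffV_le (h : UniformNetBounds f f1 f2 f3 f4 K ρ B) (i : StepData K ρ) :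
    |coeffV f1 f2 i.c| ≤ 6 * B ^ 3 := by
  have hB0 : 0 ≤ B := (norm_nonneg _).trans (h.b1 _ i.mem _ (base_mem i))
  calc _ ≤ _ := abs_tripleProduct_le _ _ _
    _ ≤ 6 * B * B * B := by
      gcongr
      · exact h.norm_apply_le₂ i.mem (base_mem i) (by simp [Prod.norm_def]) (by simp [Prod.norm_def])
      · exact h.norm_apply_le i.mem (base_mem i) (by simp [Prod.norm_def])
      · exact h.norm_apply_le i.mem (base_mem i) (by simp [Prod.norm_def])
    _ = _ := by ring

/-- One step along an odd column: a perturbed vertex can be continued so that both adjacent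
quadrangles are planar, and the perturbation grows by a factor `1 + O(ε)` only. -/
theorem exists_step (h : UniformNetBounds f f1 f2 f3 f4 K ρ B) (hρ : 0 < ρ) (hB0 : 0 ≤ B) :
    ∃ C ≥ (0 : ℝ), ∃ r > (0 : ℝ), ∃ ε₁ > (0 : ℝ), ∀ c ∈ K, ∀ ε, 0 < ε → ε < ε₁ →
      ∀ τ : ℝ, (τ = 1 ∨ τ = -1) → ∀ w : ℝ × ℝ, ‖w‖ ≤ r →
        ∃ w' : ℝ × ℝ, ‖w'‖ ≤ (1 + C * ε) * ‖w‖ + C * ε ^ 2 ∧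
          ∀ σ : ℝ, (σ = 1 ∨ σ = -1) → quadVolume f c ε σ τ (w, w') = 0 := by
  obtain ⟨S, hS, hV⟩ := h.exists_expansion
  obtain ⟨A, hA0, hA⟩ := hS.exists_nonneg
  -- `C * ε * (ε + ‖w‖)` dominates twice the displacement of `0` under the map `Ψ` below. The radius
  -- `r` and the third bound on `ε` each contribute at most `1 / 4` to the Lipschitz constant of
  -- `Ψ`; the last bound on `ε` keeps the fixed point within `r`.
  set C := 4 * B * (100 * B ^ 3 + A) with hC
  set r := 1 / (2000 * (B ^ 4 + 1)) with hr
  have hr0 : 0 < r := by positivity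
  have hr1 : 2 * r ≤ 1 := by
    rw [hr, ← mul_div_assoc, mul_one, div_le_one (by positivity)]
    nlinarith [pow_nonneg hB0 4]
  have hrB : 480 * B ^ 4 * r ≤ 1 / 4 := by
    rw [hr, mul_one_div, div_le_iff₀ (by positivity)]
    nlinarith [pow_nonneg hB0 4]
  have hC0 : 0 ≤ C := by positivity
  refine ⟨C, hC0, r, hr0, min (min (1 / 2) (ρ / 2)) (min (1 / (8 * (B * A + 1))) (r / (C + 1))),
    by positivity, fun c hc ε hε hε₁ τ hτ w hw => ?_⟩
  simp only [lt_min_iff] at hε₁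
  obtain ⟨⟨h1, h2⟩, h3, h4⟩ := hε₁
  have hBA : 2 * B * (ε * A) ≤ 1 / 4 := by
    rw [lt_div_iff₀ (by positivity)] at h3
    nlinarith [mul_nonneg hB0 hA0]
  have hCr : C * ε ≤ r := by
    rw [lt_div_iff₀ (by positivity)] at h4
    nlinarith
  let i : (σ : ℝ) → (σ = 1 ∨ σ = -1) → StepData K ρ := fun σ hσ =>
    ⟨c, ε, σ, τ, hc, hε, by linarith, by linarith, hσ, hτ⟩
  let ip : StepData K ρ := i 1 (Or.inl rfl)
  let im : StepData K ρ := i (-1) (Or.inr rfl)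
  set L := coeffU f1 f2 c with hL
  set N := coeffV f1 f2 c with hN
  have hL0 : L ≠ 0 := h.nonparabolic_u c hc
  have hN0 : N ≠ 0 := h.nonparabolic_v c hc
  have hLi : |L⁻¹| ≤ B := h.inv_u c hc
  have hNi : |N⁻¹| ≤ B := h.inv_v c hc
  have hLB : |L| ≤ 6 * B ^ 3 := h.abs_coeffU_le ip
  have hNB : |N| ≤ 6 * B ^ 3 := h.abs_coeffV_le ip
  -- For `w' = (w.1, -w.2) + z`, planarity on side `σ` reads `-(τ * L / 2) * z.1 + σ * N / 2 * z.2 +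
  -- err z = 0`.
  let err : StepData K ρ → ℝ × ℝ → ℝ := fun j z =>
    quadModelErr L N j.σ τ w z + ε * S j (w, (w.1, -w.2) + z)
  have hrefl : ‖(w.1, -w.2)‖ = ‖w‖ := by simp [Prod.norm_def]
  have hmem : ∀ z : ℝ × ℝ, ‖z‖ ≤ r → (w, (w.1, -w.2) + z) ∈
      Metric.closedBall (0 : (ℝ × ℝ) × (ℝ × ℝ)) 1 := fun z hz => by
    rw [Metric.mem_closedBall, dist_zero_right]
    have := norm_add_le (w.1, -w.2) z
    exact norm_prod_le_iff.2 ⟨by linarith, by linarith⟩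
  have hlip : ∀ j : StepData K ρ, ∀ z z', ‖z‖ ≤ r → ‖z'‖ ≤ r →
      |err j z - err j z'| ≤ (240 * B ^ 3 * r + ε * A) * ‖z - z'‖ := fun j z z' hz hz' => by
    have a1 := abs_quadModelErr_sub_le L N j.hσ hτ (by linarith) hw hz hz'
    have a2 := (hA j _ (hmem z hz)).2 _ (hmem z' hz')
    have ed : dist (w, (w.1, -w.2) + z) (w, (w.1, -w.2) + z') = ‖z - z'‖ := by
      rw [Prod.dist_eq, dist_self, dist_add_left, dist_eq_norm]
      exact max_eq_right (norm_nonneg _)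
    rw [ed, Real.norm_eq_abs] at a2
    calc _ = |(quadModelErr L N j.σ τ w z - quadModelErr L N j.σ τ w z') +
          ε * (S j (w, (w.1, -w.2) + z) - S j (w, (w.1, -w.2) + z'))| := by
          congr 1; simp only [err]; ring
      _ ≤ 20 * (|L| + |N|) * r * ‖z - z'‖ + ε * (A * ‖z - z'‖) := by
          refine (abs_add_le _ _).trans ?_
          rw [abs_mul, abs_of_pos hε]
          gcongr
      _ ≤ 20 * (6 * B ^ 3 + 6 * B ^ 3) * r * ‖z - z'‖ + ε * (A * ‖z - z'‖) := by gcongr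
      _ = _ := by ring
  -- The model vanishes at `0`, so the sixth order bound makes `S` itself of order `ε` there. Mere
  -- boundedness of `S` would add `O(ε)` per step, which sums to order `1` along a column.
  have hS0 : ∀ σ (hσ : σ = 1 ∨ σ = -1), |S (i σ hσ) 0| ≤ 100 * B ^ 3 * ε := fun σ hσ => by
    have b1 := h.abs_quadVolume_zero_le (i σ hσ)
    have b2 := hV (i σ hσ) 0
    have b3 : quadModel (coeffU f1 f2 (i σ hσ).c) (coeffV f1 f2 (i σ hσ).c) (i σ hσ).σ
        (i σ hσ).τ 0 = 0 := by
      have := quadModelErr_zero (coeffU f1 f2 (i σ hσ).c) (coeffV f1 f2 (i σ hσ).c) σ τ hτ 0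
      simpa [quadModelErr, ← Prod.zero_eq_mk] using this
    rw [b2, b3] at b1
    have e : |ε ^ 4 * (0 + ε * S (i σ hσ) 0)| = ε ^ 5 * |S (i σ hσ) 0| := by
      rw [zero_add, abs_mul, abs_mul, abs_of_pos hε, abs_of_pos (pow_pos hε 4)]; ring
    have b4 : ε ^ 5 * |S (i σ hσ) 0| ≤ ε ^ 5 * (100 * B ^ 3 * ε) := by
      rw [← e]; refine b1.trans (le_of_eq ?_); change 100 * B ^ 3 * ε ^ 6 = _; ring
    exact le_of_mul_le_mul_left b4 (pow_pos hε 5)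
  have herr0 : ∀ σ (hσ : σ = 1 ∨ σ = -1), |err (i σ hσ) 0| ≤ ε * (100 * B ^ 3 * ε + A * ‖w‖) :=
      fun σ hσ => by
    have a2 := (hA (i σ hσ) _ (hmem 0 (by simpa using hr0.le))).2 0 (by simp)
    have ed : dist (w, (w.1, -w.2) + (0 : ℝ × ℝ)) 0 = ‖w‖ := by
      rw [dist_zero_right, add_zero, Prod.norm_def]
      simp only [hrefl, max_self]
    rw [ed, Real.norm_eq_abs] at a2
    simp only [err, quadModelErr_zero L N _ τ hτ w, zero_add]
    rw [abs_mul, abs_of_pos hε]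
    gcongr
    have := abs_add_le (S (i σ hσ) (w, (w.1, -w.2) + 0) - S (i σ hσ) 0) (S (i σ hσ) 0)
    rw [sub_add_cancel] at this
    linarith [hS0 σ hσ]
  -- The sum of the two equations for `σ = 1` and `σ = -1` isolates `z.1`, their difference `z.2`.
  -- Solutions are thus the fixed points of `Ψ`.
  let Ψ : ℝ × ℝ → ℝ × ℝ := fun z =>
    (τ * L⁻¹ * (err ip z + err im z), -N⁻¹ * (err ip z - err im z))
  have hτ1 : |τ| = 1 := by rcases hτ with h | h <;> simp [h]
  have hΨ0 : ‖Ψ 0‖ ≤ 2 * B * (ε * (100 * B ^ 3 * ε + A * ‖w‖)) := by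
    have ap := herr0 1 (Or.inl rfl)
    have am := herr0 (-1) (Or.inr rfl)
    refine norm_prod_le_iff.2 ⟨?_, ?_⟩
    · simp only [Ψ, Real.norm_eq_abs, abs_mul, hτ1, one_mul]
      calc _ ≤ B * (ε * (100 * B ^ 3 * ε + A * ‖w‖) + ε * (100 * B ^ 3 * ε + A * ‖w‖)) := by
            gcongr
            exact (abs_add_le _ _).trans (add_le_add ap am)
        _ = _ := by ring
    · simp only [Ψ, Real.norm_eq_abs, abs_mul, abs_neg]
      calc _ ≤ B * (ε * (100 * B ^ 3 * ε + A * ‖w‖) + ε * (100 * B ^ 3 * ε + A * ‖w‖)) := by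
            gcongr
            exact (abs_sub _ _).trans (add_le_add ap am)
        _ = _ := by ring
  have hΨ : ∀ z z', ‖z‖ ≤ r → ‖z'‖ ≤ r → ‖Ψ z - Ψ z'‖ ≤ 1 / 2 * ‖z - z'‖ := fun z z' hz hz' => by
    have ap := hlip ip z z' hz hz'
    have am := hlip im z z' hz hz'
    have fin : B * ((240 * B ^ 3 * r + ε * A) * ‖z - z'‖ + (240 * B ^ 3 * r + ε * A) * ‖z - z'‖) ≤
        1 / 2 * ‖z - z'‖ := by
      calc _ = (480 * B ^ 4 * r + 2 * B * (ε * A)) * ‖z - z'‖ := by ring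
        _ ≤ _ := by gcongr; linarith
    refine norm_prod_le_iff.2 ⟨?_, ?_⟩
    · refine le_trans ?_ fin
      have e : (Ψ z - Ψ z').1 = τ * L⁻¹ * ((err ip z - err ip z') + (err im z - err im z')) := by
        simp only [Ψ, Prod.fst_sub]; ring
      rw [e, Real.norm_eq_abs, abs_mul, abs_mul, hτ1, one_mul]
      gcongr
      exact (abs_add_le _ _).trans (add_le_add ap am)
    · refine le_trans ?_ fin
      have e : (Ψ z - Ψ z').2 = -N⁻¹ * ((err ip z - err ip z') - (err im z - err im z')) := by
        simp only [Ψ, Prod.snd_sub]; ring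
      rw [e, Real.norm_eq_abs, abs_mul, abs_neg]
      gcongr
      exact (abs_sub _ _).trans (add_le_add ap am)
  have hC2 : 2 * (2 * B * (ε * (100 * B ^ 3 * ε + A * ‖w‖))) ≤ C * ε * (ε + ‖w‖) := by
    have : 0 ≤ B * ε * (100 * B ^ 3 * ‖w‖ + A * ε) := by positivity
    rw [hC]; nlinarith
  obtain ⟨z, hz, hfix⟩ := exists_fixedPoint_of_half_lipschitz (Ψ := Ψ) (r := r) (by
    calc _ ≤ C * ε * (ε + ‖w‖) := by linarith
      _ ≤ r * 1 := by gcongr; linarith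
      _ = r := mul_one r) hΨ
  refine ⟨(w.1, -w.2) + z, ?_, fun σ hσ => ?_⟩
  · have := norm_add_le (w.1, -w.2) z
    nlinarith
  · have z1 : τ * L⁻¹ * (err ip z + err im z) = z.1 := congrArg Prod.fst hfix
    have z2 : -N⁻¹ * (err ip z - err im z) = z.2 := congrArg Prod.snd hfix
    have hV' := hV (i σ hσ) (w, (w.1, -w.2) + z)
    refine hV'.trans (mul_eq_zero_of_right _ ?_)
    have e : quadModel L N σ τ (w, (w.1, -w.2) + z) + ε * S (i σ hσ) (w, (w.1, -w.2) + z) =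
        (-(τ * L / 2) * z.1 + σ * N / 2 * z.2) + err (i σ hσ) z := by
      simp only [err, quadModelErr, i]; ring
    refine e.trans ?_
    have y1 : L * z.1 = τ * (err ip z + err im z) := by
      rw [← z1]; field_simp
    have y2 : N * z.2 = -(err ip z - err im z) := by
      rw [← z2]; field_simp
    have ττ : τ * τ = 1 := by rcases hτ with rfl | rfl <;> norm_num
    rcases hσ with rfl | rfl
    · change _ + err ip z = 0
      linear_combination -(τ / 2) * y1 + 1 / 2 * y2 - (err ip z + err im z) / 2 * ττ
    · change _ + err im z = 0
      linear_combination -(τ / 2) * y1 - 1 / 2 * y2 - (err ip z + err im z) / 2 * ττ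

end UniformNetBounds
end Step

/-! ### Uniform bounds from compactness -/

section Existence

variable {f : ℝ × ℝ → E3} {Ω K : Set (ℝ × ℝ)}

theorem fderiv_fderiv_apply {p : ℝ × ℝ} (h : DifferentiableAt ℝ (fderiv ℝ f) p) (e e' : ℝ × ℝ) :
    fderiv ℝ (fun q => fderiv ℝ f q e) p e' = fderiv ℝ (fderiv ℝ f) p e' e := by
  rw [(h.hasFDerivAt.clm_apply (hasFDerivAt_const e p)).fderiv]
  simp

theorem continuous_tripleProduct :
    Continuous fun p : E3 × E3 × E3 => tripleProduct p.1 p.2.1 p.2.2 := by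
  simp only [tripleProduct_apply]
  fun_prop

theorem ContinuousOn.tripleProduct {X : Type*} [TopologicalSpace X] {s : Set X} {x y z : X → E3}
    (hx : ContinuousOn x s) (hy : ContinuousOn y s) (hz : ContinuousOn z s) :
    ContinuousOn (fun t => tripleProduct (x t) (y t) (z t)) s :=
  continuous_tripleProduct.comp_continuousOn (f := fun t => (x t, y t, z t))
    (hx.prodMk (hy.prodMk hz))

/-- A map with continuous derivatives up to order four has uniform bounds near a compact set. -/
theorem exists_uniformNetBounds_of_continuousOn {f1 : ℝ × ℝ → ℝ × ℝ →L[ℝ] E3}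
    {f2 : ℝ × ℝ → ℝ × ℝ →L[ℝ] ℝ × ℝ →L[ℝ] E3}
    {f3 : ℝ × ℝ → ℝ × ℝ →L[ℝ] ℝ × ℝ →L[ℝ] ℝ × ℝ →L[ℝ] E3}
    {f4 : ℝ × ℝ → ℝ × ℝ →L[ℝ] ℝ × ℝ →L[ℝ] ℝ × ℝ →L[ℝ] ℝ × ℝ →L[ℝ] E3}
    (hΩ : IsOpen Ω) (hK : IsCompact K) (hKΩ : K ⊆ Ω)
    (d0 : ∀ x ∈ Ω, HasFDerivAt f (f1 x) x) (d1 : ∀ x ∈ Ω, HasFDerivAt f1 (f2 x) x)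
    (d2 : ∀ x ∈ Ω, HasFDerivAt f2 (f3 x) x) (d3 : ∀ x ∈ Ω, HasFDerivAt f3 (f4 x) x)
    (s4 : ContinuousOn f4 Ω) (hsymm : ∀ x ∈ Ω, ∀ e e', f2 x e e' = f2 x e' e)
    (hconj : ∀ x ∈ Ω, ∃ a b : ℝ, f2 x (0, 1) (1, 0) = a • f1 x (1, 0) + b • f1 x (0, 1))
    (hu : ∀ x ∈ Ω, tripleProduct (f2 x (1, 0) (1, 0)) (f1 x (1, 0)) (f1 x (0, 1)) ≠ 0)
    (hv : ∀ x ∈ Ω, tripleProduct (f2 x (0, 1) (0, 1)) (f1 x (1, 0)) (f1 x (0, 1)) ≠ 0) :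
    ∃ ρ > 0, ∃ B ≥ 0, (∀ c ∈ K, Metric.closedBall c (2 * ρ) ⊆ Ω) ∧
      UniformNetBounds f f1 f2 f3 f4 K ρ B := by
  have s1 : ContinuousOn f1 Ω := fun x hx => (d1 x hx).continuousAt.continuousWithinAt
  have s2 : ContinuousOn f2 Ω := fun x hx => (d2 x hx).continuousAt.continuousWithinAt
  have s3 : ContinuousOn f3 Ω := fun x hx => (d3 x hx).continuousAt.continuousWithinAt
  have c1 : ∀ e, ContinuousOn (fun x => f1 x e) Ω := fun e => s1.clm_apply continuousOn_const
  have c2 : ∀ e e', ContinuousOn (fun x => f2 x e e') Ω := fun e e' =>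
    (s2.clm_apply continuousOn_const).clm_apply continuousOn_const
  have ct : ∀ e, ContinuousOn (fun x => tripleProduct (f2 x e e) (f1 x (1, 0)) (f1 x (0, 1))) Ω :=
    fun e => (c2 e e).tripleProduct (c1 _) (c1 _)
  obtain ⟨δ, hδ, hδΩ⟩ := hK.exists_cthickening_subset_open hΩ hKΩ
  have hKc : IsCompact (Metric.cthickening δ K) := hK.cthickening
  obtain ⟨B1, h1⟩ := hKc.exists_bound_of_continuousOn (s1.mono hδΩ)
  obtain ⟨B2, h2⟩ := hKc.exists_bound_of_continuousOn (s2.mono hδΩ)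
  obtain ⟨B3, h3⟩ := hKc.exists_bound_of_continuousOn (s3.mono hδΩ)
  obtain ⟨B4, h4⟩ : ∃ B4, ∀ x ∈ Metric.cthickening δ K, ‖f4 x‖ ≤ B4 := hKc.exists_bound_of_continuousOn (s4.mono hδΩ)
  obtain ⟨B5, h5⟩ := hK.exists_bound_of_continuousOn
    (((ct (1, 0)).mono hKΩ).inv₀ fun x hx => hu x (hKΩ hx))
  obtain ⟨B6, h6⟩ := hK.exists_bound_of_continuousOn
    (((ct (0, 1)).mono hKΩ).inv₀ fun x hx => hv x (hKΩ hx))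
  -- With `ρ = δ / 2`, balls of radius `ρ` about points within `ρ` of `K` still lie in the
  -- thickening; centres of quadrangles are such points.
  have hball : ∀ c ∈ K, Metric.closedBall c (2 * (δ / 2)) ⊆ Metric.cthickening δ K :=
    fun c hc => by
      rw [mul_div_cancel₀ _ two_ne_zero]
      exact Metric.closedBall_subset_cthickening hc δ
  obtain ⟨B, hB, e1, e2, e3, e4, e5, e6⟩ : ∃ B ≥ 0, B1 ≤ B ∧ B2 ≤ B ∧ B3 ≤ B ∧ B4 ≤ B ∧ B5 ≤ B ∧
      B6 ≤ B := by
    refine ⟨max 0 (max B1 (max B2 (max B3 (max B4 (max B5 B6))))), ?_⟩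
    simp
  refine ⟨δ / 2, by positivity, B, hB, fun c hc => (hball c hc).trans hδΩ, ?_⟩
  have hΩb : ∀ c ∈ K, ∀ x ∈ Metric.closedBall c (2 * (δ / 2)), x ∈ Ω := fun c hc x hx =>
    hδΩ (hball c hc hx)
  refine
    { tower := fun c hc m hm => ?_
      d3 := fun c hc x hx => d3 x (hΩb c hc x hx)
      b1 := fun c hc x hx => (h1 x (hball c hc hx)).trans e1
      b2 := fun c hc x hx => (h2 x (hball c hc hx)).trans e2
      b3 := fun c hc x hx => (h3 x (hball c hc hx)).trans e3
      b4 := fun c hc x hx => (h4 x (hball c hc hx)).trans e4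
      conj := fun c hc x hx => hconj x (hΩb c hc x hx)
      nonparabolic_u := fun c hc => hu c (hKΩ hc)
      nonparabolic_v := fun c hc => hv c (hKΩ hc)
      inv_u := fun c hc => (h5 c hc).trans e5
      inv_v := fun c hc => (h6 c hc).trans e6 }
  have hsub : Metric.closedBall m (δ / 2) ⊆ Metric.closedBall c (2 * (δ / 2)) :=
    Metric.closedBall_subset_closedBall' (by rw [Metric.mem_closedBall] at hm; linarith)
  have hmΩ : m ∈ Ω := hΩb c hc m (hsub (Metric.mem_closedBall_self (by positivity)))
  exact ⟨fun x hx => d0 x (hΩb c hc x (hsub hx)), fun x hx => d1 x (hΩb c hc x (hsub hx)),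
    fun x hx => d2 x (hΩb c hc x (hsub hx)), hsymm m hmΩ⟩

/-- Near a compact set of parameters a smooth conjugate net without parabolic points has uniform
bounds. -/
theorem IsSmoothConjugateNet.exists_uniformNetBounds (hf : IsSmoothConjugateNet f Ω)
    (hpar : ∀ p ∈ Ω, ¬ IsParabolicPoint f p) (hK : IsCompact K) (hKΩ : K ⊆ Ω) :
    ∃ ρ > 0, ∃ B ≥ 0, (∀ c ∈ K, Metric.closedBall c (2 * ρ) ⊆ Ω) ∧
      UniformNetBounds f (fderiv ℝ f) (fderiv ℝ (fderiv ℝ f)) (fderiv ℝ (fderiv ℝ (fderiv ℝ f)))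
        (fderiv ℝ (fderiv ℝ (fderiv ℝ (fderiv ℝ f)))) K ρ B := by
  have hΩ := hf.isOpen
  have s0 : ContDiffOn ℝ ∞ f Ω := hf.smooth
  have s1 : ContDiffOn ℝ ∞ (fderiv ℝ f) Ω := s0.fderiv_of_isOpen hΩ (by simp)
  have s2 : ContDiffOn ℝ ∞ (fderiv ℝ (fderiv ℝ f)) Ω := s1.fderiv_of_isOpen hΩ (by simp)
  have s3 : ContDiffOn ℝ ∞ (fderiv ℝ (fderiv ℝ (fderiv ℝ f))) Ω := s2.fderiv_of_isOpen hΩ (by simp)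
  have s4 : ContDiffOn ℝ ∞ (fderiv ℝ (fderiv ℝ (fderiv ℝ (fderiv ℝ f)))) Ω :=
    s3.fderiv_of_isOpen hΩ (by simp)
  have hd : ∀ {G : Type} [NormedAddCommGroup G] [NormedSpace ℝ G] {g : ℝ × ℝ → G},
      ContDiffOn ℝ ∞ g Ω → ∀ x ∈ Ω, HasFDerivAt g (fderiv ℝ g x) x := fun hg x hx =>
    ((hg.differentiableOn (by simp)).differentiableAt (hΩ.mem_nhds hx)).hasFDerivAt
  have d1 : ∀ x ∈ Ω, DifferentiableAt ℝ (fderiv ℝ f) x := fun x hx => (hd s1 x hx).differentiableAt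
  obtain ⟨a, b, hab⟩ := hf.conjugate
  have hconj : ∀ x ∈ Ω, fderiv ℝ (fderiv ℝ f) x (0, 1) (1, 0) =
      a x • fderiv ℝ f x (1, 0) + b x • fderiv ℝ f x (0, 1) := fun x hx => by
    rw [← fderiv_fderiv_apply (d1 x hx)]
    exact hab x hx
  -- Conjugacy makes the mixed coefficient vanish everywhere, so at a nonparabolic point both other
  -- coefficients are nonzero.
  have hmix : ∀ x ∈ Ω, tripleProduct (partialV (partialU f) x) (partialU f x) (partialV f x) = 0 :=
    fun x hx => by
      rw [hab x hx]
      simp only [tripleProduct_apply, PiLp.add_apply, PiLp.smul_apply, smul_eq_mul]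
      ring
  have hu : ∀ x ∈ Ω, tripleProduct (fderiv ℝ (fderiv ℝ f) x (1, 0) (1, 0)) (fderiv ℝ f x (1, 0))
      (fderiv ℝ f x (0, 1)) ≠ 0 := fun x hx h => by
    rw [← fderiv_fderiv_apply (d1 x hx)] at h
    exact hpar x hx ⟨hmix x hx, Or.inl h⟩
  have hv : ∀ x ∈ Ω, tripleProduct (fderiv ℝ (fderiv ℝ f) x (0, 1) (0, 1)) (fderiv ℝ f x (1, 0))
      (fderiv ℝ f x (0, 1)) ≠ 0 := fun x hx h => by
    rw [← fderiv_fderiv_apply (d1 x hx)] at h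
    exact hpar x hx ⟨hmix x hx, Or.inr h⟩
  exact exists_uniformNetBounds_of_continuousOn hΩ hK hKΩ (hd s0) (hd s1) (hd s2) (hd s3)
    s4.continuousOn
    (fun x hx => ((s0.contDiffAt (hΩ.mem_nhds hx)).isSymmSndFDerivAt
      (by simpa using WithTop.coe_le_coe.2 (le_top (a := (2 : ℕ∞))))).eq)
    (fun x hx => ⟨a x, b x, hconj x hx⟩) hu hv

end Existence

/-! ### Iterating the step along a column -/

section Columns

/-- A discrete Grönwall inequality for a sequence whose increments are controlled as long as it
stays small. -/
theorem le_of_perturbed_growth {a : ℕ → ℝ} {C r ε T : ℝ} (hC : 0 ≤ C) (hε : 0 < ε)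
    (h0 : a 0 = 0) (ha : ∀ n, a n ≤ r → a (n + 1) ≤ (1 + C * ε) * a n + C * ε ^ 2)
    (hT : 0 ≤ T) (hr : C * T * Real.exp (C * T) * ε ≤ r) (n : ℕ) (hn : n * ε ≤ T) :
    a n ≤ C * T * Real.exp (C * T) * ε := by
  -- The induction bound `n C ε² exp (C ε n)` stays below `r` while `n ε ≤ T`, which is what allows
  -- the growth hypothesis to be applied at the next step.
  have aux : ∀ n : ℕ, n * ε ≤ T →
      n * (C * ε ^ 2) * Real.exp (C * ε * n) ≤ C * T * Real.exp (C * T) * ε := fun n hn => by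
    calc _ = C * (n * ε) * Real.exp (C * (n * ε)) * ε := by
          rw [show C * ε * n = C * (n * ε) by ring]; ring
      _ ≤ _ := by gcongr
  suffices h : ∀ n : ℕ, n * ε ≤ T → a n ≤ n * (C * ε ^ 2) * Real.exp (C * ε * n) from
    (h n hn).trans (aux n hn)
  intro n
  induction n with
  | zero => intro _; simp [h0]
  | succ n ih =>
    intro hn
    push_cast at hn ⊢
    have hn' : n * ε ≤ T := by nlinarith
    have h1 := ih hn'
    have h2 := ha n (h1.trans ((aux n hn').trans hr))
    have h3 : 1 + C * ε ≤ Real.exp (C * ε) := by linarith [Real.add_one_le_exp (C * ε)]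
    have h4 : Real.exp (C * ε * (n + 1)) = Real.exp (C * ε) * Real.exp (C * ε * n) := by
      rw [← Real.exp_add]; ring_nf
    have h5 : 1 ≤ Real.exp (C * ε * (n + 1)) := Real.one_le_exp (by positivity)
    calc _ ≤ (1 + C * ε) * a n + C * ε ^ 2 := h2
      _ ≤ Real.exp (C * ε) * (n * (C * ε ^ 2) * Real.exp (C * ε * n)) +
          C * ε ^ 2 * Real.exp (C * ε * (n + 1)) := by
        refine add_le_add ?_ (le_mul_of_one_le_right (by positivity) h5)
        calc _ ≤ (1 + C * ε) * (n * (C * ε ^ 2) * Real.exp (C * ε * n)) := by gcongr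
          _ ≤ _ := by gcongr
      _ = _ := by rw [h4]; ring

theorem exists_seq_of_step {α : Type*} (x₀ : α) {R : ℕ → α → α → Prop}
    (h : ∀ n x, ∃ y, R n x y) : ∃ W : ℕ → α, W 0 = x₀ ∧ ∀ n, R n (W n) (W (n + 1)) := by
  choose g hg using h
  exact ⟨fun n => Nat.rec x₀ g n, rfl, fun n => hg n _⟩

variable {f : ℝ × ℝ → E3} {K : Set (ℝ × ℝ)} {C r ε : ℝ} (p₀ : ℝ × ℝ)

theorem latticePoint_add_smul (ε : ℝ) (i j k l : ℤ) :
    latticePoint p₀ ε i j + ε • ((k : ℝ), (l : ℝ)) = latticePoint p₀ ε (i + k) (j + l) := by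
  ext <;> simp [latticePoint] <;> ring

/-- The perturbations of one half of a column of the lattice. -/
theorem exists_half_column (hC : 0 ≤ C) (hε : 0 < ε) {t : ℤ} (ht : t = 1 ∨ t = -1)
    (hstep : ∀ c ∈ K, ∀ τ : ℝ, (τ = 1 ∨ τ = -1) → ∀ w : ℝ × ℝ, ‖w‖ ≤ r →
        ∃ w' : ℝ × ℝ, ‖w'‖ ≤ (1 + C * ε) * ‖w‖ + C * ε ^ 2 ∧
          ∀ σ : ℝ, (σ = 1 ∨ σ = -1) → quadVolume f c ε σ τ (w, w') = 0)
    {T : ℝ} (hT : 0 ≤ T) (hr : C * T * Real.exp (C * T) * ε ≤ r) (i : ℤ)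
    (hTK : ∀ n : ℤ, latticePoint p₀ ε i n ∈ K → |n| * ε ≤ T) :
    ∃ W : ℕ → ℝ × ℝ, W 0 = 0 ∧
      (∀ n : ℕ, latticePoint p₀ ε i (t * n) ∈ K → ‖W n‖ ≤ C * T * Real.exp (C * T) * ε) ∧
      ∀ n : ℕ, latticePoint p₀ ε i (t * n) ∈ K → ∀ s : ℤ, (s = 1 ∨ s = -1) →
        Coplanar ℝ {f (latticePoint p₀ ε (i + s) (t * n)),
          f (latticePoint p₀ ε (i + s) (t * (n + 1))),
          f (latticePoint p₀ ε i (t * n) + ε • W n),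
          f (latticePoint p₀ ε i (t * (n + 1)) + ε • W (n + 1))} := by
  -- The relation has to be total. Where the base vertex is outside `K`, or the perturbation exceeds
  -- `r`, the default `0` satisfies what remains of it. The growth estimate does not mention `K`, so
  -- a column may leave `K` and enter it again.
  obtain ⟨W, hW0, hW⟩ := exists_seq_of_step (0 : ℝ × ℝ)
    (R := fun n w w' => ‖w‖ ≤ r → ‖w'‖ ≤ (1 + C * ε) * ‖w‖ + C * ε ^ 2 ∧
      (latticePoint p₀ ε i (t * n) ∈ K → ∀ σ : ℝ, (σ = 1 ∨ σ = -1) →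
        quadVolume f (latticePoint p₀ ε i (t * n)) ε σ t (w, w') = 0)) (fun n w => by
      by_cases hw : ‖w‖ ≤ r
      · by_cases hK : latticePoint p₀ ε i (t * n) ∈ K
        · obtain ⟨w', h1, h2⟩ := hstep _ hK t (by rcases ht with rfl | rfl <;> simp) w hw
          exact ⟨w', fun _ => ⟨h1, fun _ => h2⟩⟩
        · exact ⟨0, fun _ => ⟨by rw [norm_zero]; positivity, fun h => absurd h hK⟩⟩
      · exact ⟨0, fun h => absurd h hw⟩)
  have hbound : ∀ n : ℕ, latticePoint p₀ ε i (t * n) ∈ K →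
      ‖W n‖ ≤ C * T * Real.exp (C * T) * ε := fun n hn => by
    refine le_of_perturbed_growth (a := fun n => ‖W n‖) hC hε (by simp [hW0])
      (fun n hn => (hW n hn).1) hT hr n ?_
    have := hTK _ hn
    rcases ht with rfl | rfl <;> simpa [abs_mul] using this
  refine ⟨W, hW0, hbound, fun n hn s hs => coplanar_of_tripleProduct_eq_zero ?_⟩
  have hV := (hW n ((hbound n hn).trans hr)).2 hn s (by rcases hs with rfl | rfl <;> simp)
  have l1 := latticePoint_add_smul p₀ ε i (t * n) s t
  have l2 := latticePoint_add_smul p₀ ε i (t * n) s 0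
  have l3 := latticePoint_add_smul p₀ ε i (t * n) 0 t
  rw [Int.cast_zero, add_zero] at l2
  rw [Int.cast_zero, add_zero] at l3
  rw [quadVolume, l1, l2, smul_add, add_comm (ε • _) (ε • _), ← add_assoc, l3] at hV
  rw [mul_add, mul_one]
  exact hV

/-- The perturbations of a column of the lattice. -/
theorem exists_column (hC : 0 ≤ C) (hε : 0 < ε)
    (hstep : ∀ c ∈ K, ∀ τ : ℝ, (τ = 1 ∨ τ = -1) → ∀ w : ℝ × ℝ, ‖w‖ ≤ r →
        ∃ w' : ℝ × ℝ, ‖w'‖ ≤ (1 + C * ε) * ‖w‖ + C * ε ^ 2 ∧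
          ∀ σ : ℝ, (σ = 1 ∨ σ = -1) → quadVolume f c ε σ τ (w, w') = 0)
    {T : ℝ} (hT : 0 ≤ T) (hr : C * T * Real.exp (C * T) * ε ≤ r) (i : ℤ)
    (hTK : ∀ n : ℤ, latticePoint p₀ ε i n ∈ K → |n| * ε ≤ T) :
    ∃ D : ℤ → ℝ × ℝ, D 0 = 0 ∧
      (∀ j, latticePoint p₀ ε i j ∈ K → ‖D j‖ ≤ C * T * Real.exp (C * T) * ε) ∧
      ∀ j, latticePoint p₀ ε i j ∈ K → latticePoint p₀ ε i (j + 1) ∈ K →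
        ∀ s : ℤ, (s = 1 ∨ s = -1) →
        Coplanar ℝ {f (latticePoint p₀ ε i j + ε • D j), f (latticePoint p₀ ε (i + s) j),
          f (latticePoint p₀ ε (i + s) (j + 1)),
          f (latticePoint p₀ ε i (j + 1) + ε • D (j + 1))} := by
  obtain ⟨W, hW0, hWb, hW⟩ := exists_half_column p₀ hC hε (Or.inl rfl) hstep hT hr i hTK
  obtain ⟨V, hV0, hVb, hV⟩ := exists_half_column p₀ hC hε (Or.inr rfl) hstep hT hr i hTK
  simp only [one_mul, neg_mul] at hWb hW hVb hV
  -- The two halves both start from `0` and so agree on row `0`.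
  let D : ℤ → ℝ × ℝ := fun j => if 0 ≤ j then W j.toNat else V (-j).toNat
  have hDW : ∀ n : ℕ, D n = W n := fun n => by simp [D]
  have hDV : ∀ n : ℕ, D (-n) = V n := fun n => by
    rcases n with _ | n
    · simp [D, hW0, hV0]
    · have : ¬ (0 : ℤ) ≤ -((n + 1 : ℕ) : ℤ) := by omega
      simp only [D, if_neg this, neg_neg, Int.toNat_natCast]
  refine ⟨D, by simpa using (hDW 0).trans hW0, fun j hj => ?_, fun j hj hj' s hs => ?_⟩
  · obtain ⟨n, rfl | rfl⟩ := j.eq_nat_or_neg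
    · rw [hDW]; exact hWb n hj
    · rw [hDV]; exact hVb n hj
  · rcases le_or_gt 0 j with h | h
    · obtain ⟨n, rfl⟩ := Int.eq_ofNat_of_zero_le h
      have := hW n hj s hs
      rw [hDW, ← Nat.cast_succ, hDW]
      refine this.subset ?_
      intro x
      simp only [Set.mem_insert_iff, Set.mem_singleton_iff, Nat.cast_succ]
      tauto
    · obtain ⟨n, hn⟩ := Int.eq_ofNat_of_zero_le (show 0 ≤ -(j + 1) by omega)
      obtain rfl : j = -((n : ℤ) + 1) := by omega
      have e : -((n : ℤ) + 1) + 1 = -n := by ring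
      rw [e] at hj' ⊢
      have := hV n hj' s hs
      rw [hDV, ← Nat.cast_succ, hDV]
      refine this.subset ?_
      intro x
      simp only [Set.mem_insert_iff, Set.mem_singleton_iff, Nat.cast_succ]
      tauto

end Columns

/-! ### Assembling the discrete net -/

theorem mainTheorem8 (Ω : Set (ℝ × ℝ)) (f : ℝ × ℝ → EuclideanSpace ℝ (Fin 3))
    (hf : IsSmoothConjugateNet f Ω) (hpar : ∀ p ∈ Ω, ¬ IsParabolicPoint f p)
    (K : Set (ℝ × ℝ)) (hK : IsCompact K) (hKΩ : K ⊆ Ω) (p₀ : ℝ × ℝ) :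
    ∃ C > (0 : ℝ), ∃ ε₀ > (0 : ℝ), ∀ ε : ℝ, 0 < ε → ε < ε₀ →
      ∃ F : ℤ → ℤ → EuclideanSpace ℝ (Fin 3),
        IsDiscreteConjugateNet {ij | latticePoint p₀ ε ij.1 ij.2 ∈ K} F ∧
        (∀ i j : ℤ, latticePoint p₀ ε i j ∈ K →
          F i j ∈ f '' Ω ∧ dist (f (latticePoint p₀ ε i j)) (F i j) ≤ C * ε ^ 2) ∧
        (∀ i j : ℤ, latticePoint p₀ ε (2 * i) j ∈ K →
          F (2 * i) j = f (latticePoint p₀ ε (2 * i) j)) ∧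
        (∀ i : ℤ, latticePoint p₀ ε i 0 ∈ K →
          F i 0 = f (latticePoint p₀ ε i 0)) := by
  obtain ⟨ρ, hρ, B, hB, hball, hnet⟩ := hf.exists_uniformNetBounds hpar hK hKΩ
  obtain ⟨C, hC, r, hr, ε₁, hε₁, hstep⟩ := hnet.exists_step hρ hB
  obtain ⟨R, hR⟩ := hK.isBounded.exists_norm_le
  -- `T` bounds the parameter height above or below row `0` of every lattice point in `K`, so at
  -- most `T / ε` steps are needed.
  set T := |R| + |p₀.2| with hTdef
  have hT : 0 ≤ T := by positivity
  set A := C * T * Real.exp (C * T) with hA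
  have hA0 : 0 ≤ A := by positivity
  -- Parameters move by at most `A ε²` and `f` is `B`-Lipschitz nearby. The bounds on `ε` serve the
  -- step, `A ε² ≤ A ε`, the Grönwall estimate, and keeping the displaced parameters within `ρ`,
  -- hence in `Ω`.
  refine ⟨B * A + 1, by positivity, min (min ε₁ 1) (min (r / (A + 1)) (ρ / (A + 1))), by positivity,
    fun ε hε hεlt => ?_⟩
  simp only [lt_min_iff] at hεlt
  obtain ⟨⟨h1, h2⟩, h3, h4⟩ := hεlt
  have hAr : A * ε ≤ r := by
    rw [lt_div_iff₀ (by positivity)] at h3; nlinarith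
  have hAρ : A * ε ≤ ρ := by
    rw [lt_div_iff₀ (by positivity)] at h4; nlinarith
  have hTK : ∀ i n : ℤ, latticePoint p₀ ε i n ∈ K → |n| * ε ≤ T := fun i n hn => by
    have a1 : |p₀.2 + n * ε| ≤ R := (norm_snd_le _).trans (hR _ hn)
    have a2 : |(n : ℝ) * ε| = |(n : ℝ)| * ε := by rw [abs_mul, abs_of_pos hε]
    have a3 := abs_sub (p₀.2 + n * ε) p₀.2
    rw [add_sub_cancel_left, a2] at a3
    push_cast
    linarith [le_abs_self R]
  choose D hD0 hDb hD using fun i : ℤ => exists_column p₀ hC hε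
    (fun c hc => hstep c hc ε hε h1) hT hAr i (hTK i)
  have hsmall : ∀ i j, latticePoint p₀ ε i j ∈ K → ‖ε • D i j‖ ≤ A * ε ^ 2 := fun i j hj => by
    rw [norm_smul, Real.norm_eq_abs, abs_of_pos hε]
    calc _ ≤ ε * (A * ε) := by gcongr; exact hDb i j hj
      _ = _ := by ring
  have hAρ2 : A * ε ^ 2 ≤ ρ := by nlinarith [mul_nonneg hA0 hε.le]
  -- Perturbations were chosen for all columns; those of even columns are discarded, so each odd
  -- column has the unperturbed neighbours assumed in `hD`.
  let F : ℤ → ℤ → EuclideanSpace ℝ (Fin 3) := fun i j =>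
    if Even i then f (latticePoint p₀ ε i j) else f (latticePoint p₀ ε i j + ε • D i j)
  have hFe : ∀ i j, Even i → F i j = f (latticePoint p₀ ε i j) := fun i j h => if_pos h
  have hFo : ∀ i j, ¬ Even i → F i j = f (latticePoint p₀ ε i j + ε • D i j) :=
    fun i j h => if_neg h
  refine ⟨F, ?_, ?_, fun i j _ => hFe _ _ (even_two_mul i), fun i _ => ?_⟩
  · intro i j m00 m10 m11 m01
    simp only [Set.mem_ofPred_eq] at m00 m10 m11 m01
    by_cases hi : Even i
    · have hi' : ¬ Even (i + 1) := by rw [Int.even_add_one]; exact not_not.2 hi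
      rw [hFe _ _ hi, hFe _ _ hi, hFo _ _ hi', hFo _ _ hi']
      have := hD (i + 1) j m10 m11 (-1) (Or.inr rfl)
      rw [add_neg_cancel_right] at this
      refine this.subset fun x => ?_
      simp only [Set.mem_insert_iff, Set.mem_singleton_iff]
      tauto
    · have hi' : Even (i + 1) := by rw [Int.even_add_one]; exact hi
      rw [hFo _ _ hi, hFo _ _ hi, hFe _ _ hi', hFe _ _ hi']
      exact hD i j m00 m01 1 (Or.inl rfl)
  · intro i j hij
    have hself : latticePoint p₀ ε i j ∈ Metric.closedBall (latticePoint p₀ ε i j) (2 * ρ) :=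
      Metric.mem_closedBall_self (by positivity)
    by_cases hi : Even i
    · rw [hFe _ _ hi, dist_self]
      exact ⟨⟨_, hball _ hij hself, rfl⟩, by positivity⟩
    · rw [hFo _ _ hi]
      have hn := hsmall i j hij
      have hmem : ∀ z : ℝ × ℝ, ‖z‖ ≤ A * ε ^ 2 → latticePoint p₀ ε i j + z ∈
          Metric.closedBall (latticePoint p₀ ε i j) (2 * ρ) := fun z hz => by
        rw [Metric.mem_closedBall, dist_eq_norm, add_sub_cancel_left]
        linarith
      have hmem' : ∀ z : ℝ × ℝ, ‖z‖ ≤ A * ε ^ 2 → latticePoint p₀ ε i j + z ∈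
          Metric.closedBall (latticePoint p₀ ε i j) ρ := fun z hz => by
        rw [Metric.mem_closedBall, dist_eq_norm, add_sub_cancel_left]
        linarith
      refine ⟨⟨_, hball _ hij (hmem _ hn), rfl⟩, ?_⟩
      have htower := hnet.tower _ hij _ (Metric.mem_closedBall_self hρ.le)
      have := norm_sub_le_of_hasFDerivAt_ball (g := fun z => f (latticePoint p₀ ε i j + z))
        (fun z hz => hasFDerivAt_comp_const_add (htower.d0 _ (hmem' z hz)))
        (fun z hz => hnet.b1 _ hij _ (hmem z hz)) (z := 0) (by simp; positivity) hn
      rw [add_zero, zero_sub, norm_neg] at this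
      rw [dist_eq_norm]
      calc _ ≤ B * ‖ε • D i j‖ := this
        _ ≤ B * (A * ε ^ 2) := by gcongr
        _ ≤ (B * A + 1) * ε ^ 2 := by nlinarith [sq_nonneg ε]
  · by_cases hi : Even i
    · exact hFe _ _ hi
    · rw [hFo _ _ hi, hD0, smul_zero, add_zero]
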